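/- **Setting.** A *locally $C^*$-algebra* is a complete Hausdorff complex topological $*$-algebra $A$ whose topology is determined by its continuous $C^*$-seminorms. Let $G$ be a (Hausdorff) locally compact group with left Haar measure $ds$ and modular function $\gamma$, and let $\alpha$ be a continuous action of $G$ on $A$: a homomorphism $t\mapsto\alpha_t$ from $G$ to the $*$-automorphisms of $A$ such that $(t,a)\mapsto\alpha_t(a)$ is jointly continuous. Assume that $\alpha$ is an *inverse limit action*: $A$ can be written as an inverse limit $\varprojlim_{\delta\in\Delta}A_\delta$ of $C^*$-algebras ($\Delta$ directed) such that there are actions $\alpha^{(\delta)}$ of $G$ on $A_\delta$, compatible with the connecting maps, with $\alpha_t=\varprojlim_\delta\alpha^{(\delta)}_t$ for all $t\in G$. On $C_c(G,A)$ consider the convolution $(f\times h)(s)=\int_G f(t)\,\alpha_t(h(t^{-1}s))\,dt$, the involution $f^\sharp(t)=\gamma(t)^{-1}\alpha_t(f(t^{-1})^*)$, and, for every $G$-invariant continuous $C^*$-seminorm $p$ on $A$, the submultiplicative $*$-seminorm $N_p(f)=\int_G p(f(s))\,ds$. (As $\alpha$ is an inverse limit action, these $p$ determine the topology of $A$.)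 Let $L^1(G,A,\alpha)$ be the Hausdorff completion of the $*$-algebra $C_c(G,A)$ with respect to the seminorms $N_p$, and extend the $N_p$ to it by continuity. The *crossed product* $A\times_\alpha G$ is the enveloping locally $C^*$-algebra of $L^1(G,A,\alpha)$, that is, the Hausdorff completion of $L^1(G,A,\alpha)$ with respect to the $C^*$-seminorms $r_p(x)=\sup\|\Phi(x)\|$, the supremum being over all $*$-representations $\Phi$ of $L^1(G,A,\alpha)$ by bounded operators on Hilbert spaces with $\|\Phi(y)\|\le N_p(y)$ for all $y$. Write $\iota:C_c(G,A)\to A\times_\alpha G$ for the canonical $*$-homomorphism. A *representation* of a topological $*$-algebra on a Hilbert space $H$ is a continuous $*$-homomorphism to the algebra $B(H)$ of bounded operators with its norm; it is *non-degenerate* if the vectors $\varphi(a)\xi$ span a dense subspace of $H$. A *non-degenerate covariant representation* of $(G,A,\alpha)$ on $H$ is a pair $(\varphi,u)$ of a non-degenerate representation $\varphi$ of $A$ and a strongly continuous unitary representation $u$ of $G$ on $H$ with $\varphi(\alpha_t(a))=u_t\varphi(a)u_t^*$ for all $t\in G$, $a\in A$. **Proposition 3.16.** For every Hilbert space $H$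 there is a bijection $(\varphi,u)\mapsto\varphi\times u$ from the set of non-degenerate covariant representations of $(G,A,\alpha)$ on $H$ onto the set of non-degenerate representations of $A\times_\alpha G$ on $H$, such that $$(\varphi\times u)(\iota(f))\,\xi=\int_G\varphi(f(t))\,u_t\,\xi\,dt\qquad\text{for all }f\in C_c(G,A),\ \xi\in H.$$ -/

import Mathlib

open MeasureTheory Topology Filter
open scoped CompactlySupported NNReal

set_option linter.unusedSectionVars false

noncomputable section

namespace LocCStar

/-! ### Seminorms on complex `*`-algebras and Hausdorff completions -/

section Seminorms

variable {E : Type*} [NonUnitalRing E] [StarRing E] [Module ℂ E]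

/-- Submultiplicative `*`-seminorms. -/
structure IsStarSeminorm (p : Seminorm ℂ E) : Prop where
  mul_le : ∀ a b, p (a * b) ≤ p a * p b
  star_eq : ∀ a, p (star a) = p a

/-- `C*`-seminorms: submultiplicative seminorms with `p (a* a) = p (a) ^ 2`. -/
structure IsCStarSeminorm (p : Seminorm ℂ E) : Prop where
  mul_le : ∀ a b, p (a * b) ≤ p a * p b
  star_mul_self : ∀ a, p (star a * a) = p a ^ 2

theorem IsCStarSeminorm.isStarSeminorm {p : Seminorm ℂ E} (hp : IsCStarSeminorm p) :
    IsStarSeminorm p := by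
  have key : ∀ a, p a ≤ p (star a) := by
    intro a
    by_contra! h
    have h1 := hp.star_mul_self a
    have h2 := hp.mul_le (star a) a
    have h3 := apply_nonneg p (star a)
    nlinarith
  refine ⟨hp.mul_le, fun a => le_antisymm ?_ (key a)⟩
  simpa using key (star a)

variable (E) in
/-- A family of submultiplicative `*`-seminorms on a complex `*`-algebra. -/
structure StarSeminormFamily where
  carrier : Set (Seminorm ℂ E)
  isStarSeminorm : ∀ p ∈ carrier, IsStarSeminorm p

namespace StarSeminormFamily

/-- The algebra `E`, to be equipped with the topology defined by the family `P`. -/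
def Carrier (_P : StarSeminormFamily E) : Type _ := E

variable (P : StarSeminormFamily E)

instance : NonUnitalRing P.Carrier := inferInstanceAs (NonUnitalRing E)
instance : StarRing P.Carrier := inferInstanceAs (StarRing E)
instance : Module ℂ P.Carrier := inferInstanceAs (Module ℂ E)
instance [IsScalarTower ℂ E E] : IsScalarTower ℂ P.Carrier P.Carrier :=
  inferInstanceAs (IsScalarTower ℂ E E)
instance [SMulCommClass ℂ E E] : SMulCommClass ℂ P.Carrier P.Carrier :=
  inferInstanceAs (SMulCommClass ℂ E E)
instance [StarModule ℂ E] : StarModule ℂ P.Carrier := inferInstanceAs (StarModule ℂ E)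

/-- The members of the family, as seminorms on `P.Carrier`. -/
def seminorm (p : P.carrier) : Seminorm ℂ P.Carrier := (p : Seminorm ℂ E)

/-- The coarsest uniform structure for which all the members of `P` are uniformly continuous. -/
instance : UniformSpace P.Carrier :=
  ⨅ p : P.carrier, (P.seminorm p).toSeminormedAddCommGroup.toUniformSpace

instance : IsUniformAddGroup P.Carrier :=
  isUniformAddGroup_iInf fun p =>
    let := (P.seminorm p).toSeminormedAddCommGroup
    inferInstance

theorem withSeminorms : WithSeminorms P.seminorm :=
  (SeminormFamily.withSeminorms_iff_uniformSpace_eq_iInf _).2 rfl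

instance : ContinuousSMul ℂ P.Carrier := P.withSeminorms.continuousSMul

instance : UniformContinuousConstSMul ℂ P.Carrier :=
  uniformContinuousConstSMul_of_continuousConstSMul _ _

instance : ContinuousMul P.Carrier := by
  have h : UniformSpace.toTopologicalSpace = ⨅ p : P.carrier,
      (P.seminorm p).toSeminormedAddCommGroup.toUniformSpace.toTopologicalSpace :=
    UniformSpace.toTopologicalSpace_iInf
  rw [h]
  refine continuousMul_iInf fun p => ?_
  let : NonUnitalSeminormedRing P.Carrier :=
    { (P.seminorm p).toSeminormedAddCommGroup, (inferInstance : NonUnitalRing P.Carrier) with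
      norm_mul_le := (P.isStarSeminorm p.1 p.2).mul_le }
  infer_instance

theorem uniformContinuous_star : UniformContinuous (star : P.Carrier → P.Carrier) := by
  refine uniformContinuous_iInf_rng.2 fun p => uniformContinuous_iInf_dom (i := p) ?_
  let := (P.seminorm p).toSeminormedAddCommGroup
  refine (AddMonoidHomClass.isometry_of_norm (starAddEquiv : P.Carrier ≃+ P.Carrier)
    fun a => ?_).uniformContinuous
  exact (P.isStarSeminorm p.1 p.2).star_eq a

theorem continuous_seminorm (p : P.carrier) : Continuous (P.seminorm p) :=
  P.withSeminorms.continuous_seminorm p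

theorem uniformContinuous_seminorm (p : P.carrier) : UniformContinuous (P.seminorm p) :=
  Seminorm.uniformContinuous_of_continuousAt_zero (P.continuous_seminorm p).continuousAt

/-- The Hausdorff completion of `E` with respect to the family of seminorms `P`. -/
abbrev HausdorffCompletion : Type _ := UniformSpace.Completion P.Carrier

namespace HausdorffCompletion

open UniformSpace (Completion)

/-- The canonical map from `E` to its completion. -/
def mk (a : E) : P.HausdorffCompletion := UniformSpace.Completion.coe' (α := P.Carrier) a

theorem denseRange_mk : DenseRange (mk P) :=
  UniformSpace.Completion.denseRange_coe (α := P.Carrier)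

theorem isDenseInducing_mk : IsDenseInducing (fun a : P.Carrier => mk P a) :=
  UniformSpace.Completion.isDenseInducing_coe

theorem mk_add (a b : E) : mk P (a + b) = mk P a + mk P b :=
  UniformSpace.Completion.coe_add (α := P.Carrier) a b

theorem mk_smul (c : ℂ) (a : E) : mk P (c • a) = c • mk P a :=
  UniformSpace.Completion.coe_smul (X := P.Carrier) c a

theorem mk_zero : mk P 0 = 0 := UniformSpace.Completion.coe_zero (α := P.Carrier)

variable {P} in
@[elab_as_elim]
theorem induction_on {C : P.HausdorffCompletion → Prop} (x : P.HausdorffCompletion) (hC : IsClosed {x | C x})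
    (h : ∀ a, C (mk P a)) : C x :=
  UniformSpace.Completion.induction_on x hC h

/-- The product of the completion: the continuous extension of the product of `E`. -/
instance : Mul P.HausdorffCompletion :=
  ⟨Function.curry <| ((isDenseInducing_mk P).prodMap (isDenseInducing_mk P)).extend
    fun x : P.Carrier × P.Carrier => mk P (x.1 * x.2)⟩

theorem mk_mul (a b : E) : mk P (a * b) = mk P a * mk P b :=
  (((isDenseInducing_mk P).prodMap (isDenseInducing_mk P)).extend_eq
    (f := fun x : P.Carrier × P.Carrier => mk P (x.1 * x.2))
    ((UniformSpace.Completion.continuous_coe P.Carrier).comp continuous_mul)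
    ((a, b) : P.Carrier × P.Carrier)).symm

instance : ContinuousMul P.HausdorffCompletion where
  continuous_mul := by
    let m := (AddMonoidHom.mul : P.Carrier →+ P.Carrier →+ P.Carrier).compr₂
      UniformSpace.Completion.toCompl
    have h : Continuous fun p : P.Carrier × P.Carrier => m p.1 p.2 :=
      (UniformSpace.Completion.continuous_coe P.Carrier).comp continuous_mul
    have di : IsDenseInducing
      (UniformSpace.Completion.toCompl : P.Carrier → Completion P.Carrier) :=
      UniformSpace.Completion.isDenseInducing_coe
    exact (di.extend_Z_bilin di h :)

/-- The involution of the completion: the continuous extension of the involution of `E`. -/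
instance : Star P.HausdorffCompletion := ⟨UniformSpace.Completion.map (star : P.Carrier → P.Carrier)⟩

instance : ContinuousStar P.HausdorffCompletion where
  continuous_star := UniformSpace.Completion.continuous_map (f := (star : P.Carrier → P.Carrier))

theorem mk_star (a : E) : mk P (star a) = star (mk P a) :=
  (UniformSpace.Completion.map_coe P.uniformContinuous_star a).symm

instance : NonUnitalRing P.HausdorffCompletion where
  zero_mul a := by
    refine induction_on a (isClosed_eq (by fun_prop) continuous_const) fun a => ?_
    rw [← mk_zero, ← mk_mul, zero_mul]
  mul_zero a := by
    refine induction_on a (isClosed_eq (by fun_prop) continuous_const) fun a => ?_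
    rw [← mk_zero, ← mk_mul, mul_zero]
  left_distrib a b c := by
    refine induction_on a (isClosed_eq (by fun_prop) (by fun_prop)) fun a => ?_
    refine induction_on b (isClosed_eq (by fun_prop) (by fun_prop)) fun b => ?_
    refine induction_on c (isClosed_eq (by fun_prop) (by fun_prop)) fun c => ?_
    rw [← mk_add, ← mk_mul, ← mk_mul, ← mk_mul, ← mk_add, mul_add]
  right_distrib a b c := by
    refine induction_on a (isClosed_eq (by fun_prop) (by fun_prop)) fun a => ?_
    refine induction_on b (isClosed_eq (by fun_prop) (by fun_prop)) fun b => ?_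
    refine induction_on c (isClosed_eq (by fun_prop) (by fun_prop)) fun c => ?_
    rw [← mk_add, ← mk_mul, ← mk_mul, ← mk_mul, ← mk_add, add_mul]
  mul_assoc a b c := by
    refine induction_on a (isClosed_eq
      ((continuous_id.mul continuous_const).mul continuous_const)
      (continuous_id.mul continuous_const)) fun a => ?_
    refine induction_on b (isClosed_eq
      ((continuous_const.mul continuous_id).mul continuous_const)
      (continuous_const.mul (continuous_id.mul continuous_const))) fun b => ?_
    refine induction_on c (isClosed_eq
      (continuous_const.mul continuous_id)
      (continuous_const.mul (continuous_const.mul continuous_id))) fun c => ?_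
    rw [← mk_mul, ← mk_mul, ← mk_mul, ← mk_mul, mul_assoc]

instance : StarRing P.HausdorffCompletion where
  star_involutive a := by
    refine induction_on a (isClosed_eq (by fun_prop) (by fun_prop)) fun a => ?_
    rw [← mk_star, ← mk_star, star_star]
  star_mul a b := by
    refine induction_on a (isClosed_eq (by fun_prop) (by fun_prop)) fun a => ?_
    refine induction_on b (isClosed_eq (by fun_prop) (by fun_prop)) fun b => ?_
    rw [← mk_mul, ← mk_star, ← mk_star, ← mk_star, ← mk_mul, star_mul]
  star_add a b := by
    refine induction_on a (isClosed_eq (by fun_prop) (by fun_prop)) fun a => ?_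
    refine induction_on b (isClosed_eq (by fun_prop) (by fun_prop)) fun b => ?_
    rw [← mk_add, ← mk_star, ← mk_star, ← mk_star, ← mk_add, star_add]

instance [IsScalarTower ℂ E E] : IsScalarTower ℂ P.HausdorffCompletion P.HausdorffCompletion where
  smul_assoc c a b := by
    refine induction_on a (isClosed_eq
      ((continuous_const_smul c).mul continuous_const)
      ((continuous_id.mul continuous_const).const_smul c)) fun a => ?_
    refine induction_on b (isClosed_eq
      (continuous_const.mul continuous_id)
      ((continuous_const.mul continuous_id).const_smul c)) fun b => ?_
    simp only [smul_eq_mul]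
    rw [← mk_smul, ← mk_mul, ← mk_mul, ← mk_smul, smul_mul_assoc]

instance [SMulCommClass ℂ E E] : SMulCommClass ℂ P.HausdorffCompletion P.HausdorffCompletion where
  smul_comm c a b := by
    refine induction_on a (isClosed_eq
      ((continuous_id.mul continuous_const).const_smul c)
      (continuous_id.mul continuous_const)) fun a => ?_
    refine induction_on b (isClosed_eq
      ((continuous_const.mul continuous_id).const_smul c)
      (continuous_const.mul (continuous_const_smul c))) fun b => ?_
    simp only [smul_eq_mul]
    rw [← mk_smul, ← mk_mul, ← mk_mul, ← mk_smul, mul_smul_comm]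

instance [StarModule ℂ E] : StarModule ℂ P.HausdorffCompletion where
  star_smul c a := by
    refine induction_on a (isClosed_eq
      ((continuous_const_smul c).star)
      (continuous_star.const_smul (star c))) fun a => ?_
    rw [← mk_smul, ← mk_star, ← mk_star, ← mk_smul, star_smul]

/-- The canonical `*`-homomorphism from `E` to its completion. -/
def of : E →⋆ₙₐ[ℂ] P.HausdorffCompletion where
  toFun := mk P
  map_smul' := mk_smul P
  map_zero' := mk_zero P
  map_add' := mk_add P
  map_mul' := mk_mul P
  map_star' := mk_star P

/-- The continuous extension to the completion of the function `p`. -/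
def extendFun (p : P.carrier) : P.HausdorffCompletion → ℝ :=
  UniformSpace.Completion.extension (P.seminorm p)

theorem continuous_extendFun (p : P.carrier) : Continuous (extendFun P p) :=
  UniformSpace.Completion.continuous_extension

theorem extendFun_mk (p : P.carrier) (a : E) : extendFun P p (mk P a) = p.1 a :=
  UniformSpace.Completion.extension_coe (P.uniformContinuous_seminorm p) a

/-- The continuous extension of a seminorm of the family `P` to the completion. -/
def extend (p : P.carrier) : Seminorm ℂ P.HausdorffCompletion :=
  have hc := continuous_extendFun P p
  Seminorm.of (extendFun P p)
    (fun x y => by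
      refine induction_on x (isClosed_le (by fun_prop) (by fun_prop)) fun a => ?_
      refine induction_on y (isClosed_le (by fun_prop) (by fun_prop)) fun b => ?_
      rw [← mk_add, extendFun_mk, extendFun_mk, extendFun_mk]
      exact map_add_le_add p.1 a b)
    (fun c x => by
      refine induction_on x (isClosed_eq
      (hc.comp (continuous_const_smul c))
      (continuous_const.mul hc)) fun a => ?_
      rw [← mk_smul, extendFun_mk, extendFun_mk]
      exact map_smul_eq_mul p.1 c a)

theorem continuous_extend (p : P.carrier) : Continuous (extend P p) := continuous_extendFun P p

theorem extend_mk (p : P.carrier) (a : E) : extend P p (mk P a) = p.1 a := extendFun_mk P p a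

theorem isStarSeminorm_extend (p : P.carrier) : IsStarSeminorm (extend P p) := by
  have hc := continuous_extend P p
  constructor
  · intro x y
    refine induction_on x (isClosed_le (by fun_prop) (by fun_prop)) fun a => ?_
    refine induction_on y (isClosed_le (by fun_prop) (by fun_prop)) fun b => ?_
    rw [← mk_mul, extend_mk, extend_mk, extend_mk]
    exact (P.isStarSeminorm p.1 p.2).mul_le a b
  · intro x
    refine induction_on x (isClosed_eq (by fun_prop) (by fun_prop)) fun a => ?_
    rw [← mk_star, extend_mk, extend_mk]
    exact (P.isStarSeminorm p.1 p.2).star_eq a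

/-- The family of the extensions to the completion of the seminorms in `P`. -/
def family : StarSeminormFamily P.HausdorffCompletion where
  carrier := Set.range (extend P)
  isStarSeminorm := by
    rintro _ ⟨p, rfl⟩
    exact isStarSeminorm_extend P p

end HausdorffCompletion

end StarSeminormFamily
end Seminorms

/-! ### Enveloping locally `C*`-algebras -/

section Enveloping

universe w

variable {E : Type w} [NonUnitalRing E] [StarRing E] [Module ℂ E]

/-- The seminorms `x ↦ ‖φ x‖`, where `φ` runs over the `*`-representations of `E` by bounded
operators on Hilbert spaces such that `‖φ x‖ ≤ p x` for all `x`. -/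
def representationSeminorms (p : Seminorm ℂ E) : Set (Seminorm ℂ E) :=
  {q | ∃ (H : Type w) (_ : NormedAddCommGroup H) (_ : InnerProductSpace ℂ H)
    (_ : CompleteSpace H) (φ : E →⋆ₙₐ[ℂ] (H →L[ℂ] H)),
      (∀ x, ‖φ x‖ ≤ p x) ∧ ∀ x, q x = ‖φ x‖}

theorem bddAbove_representationSeminorms (p : Seminorm ℂ E) :
    BddAbove (representationSeminorms p) := by
  refine ⟨p, ?_⟩
  rintro q ⟨H, _, _, _, φ, h1, h2⟩ x
  exact (h2 x).trans_le (h1 x)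

/-- `r_p (x) = sup ‖φ x‖`, the supremum being taken over all the `*`-representations `φ` of `E` on
Hilbert spaces such that `‖φ x‖ ≤ p x` for all `x`. -/
def envelopingSeminorm (p : Seminorm ℂ E) : Seminorm ℂ E :=
  sSup (representationSeminorms p)

theorem representationSeminorms_nonempty (p : Seminorm ℂ E) :
    (representationSeminorms p).Nonempty :=
  ⟨0, EuclideanSpace ℂ (PEmpty.{w + 1}), inferInstance, inferInstance, inferInstance, 0,
    fun x => by simp, fun x => by simp⟩

theorem isCStarSeminorm_envelopingSeminorm (p : Seminorm ℂ E) :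
    IsCStarSeminorm (envelopingSeminorm p) := by
  have hb := bddAbove_representationSeminorms p
  have hne : Nonempty (representationSeminorms p) := (representationSeminorms_nonempty p).to_subtype
  have hle (q : representationSeminorms p) (x : E) : q.1 x ≤ envelopingSeminorm p x :=
    le_csSup hb q.2 x
  have hsup (x : E) (c : ℝ) (h : ∀ q : representationSeminorms p, q.1 x ≤ c) :
      envelopingSeminorm p x ≤ c := by
    rw [envelopingSeminorm, Seminorm.sSup_apply hb]
    exact ciSup_le h
  constructor
  · intro a b
    refine hsup _ _ fun q => ?_
    obtain ⟨H, _, _, _, φ, -, h2⟩ := q.2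
    calc q.1 (a * b) = ‖φ a * φ b‖ := by rw [h2, map_mul]
      _ ≤ ‖φ a‖ * ‖φ b‖ := norm_mul_le _ _
      _ = q.1 a * q.1 b := by rw [h2, h2]
      _ ≤ _ := mul_le_mul (hle q a) (hle q b) (apply_nonneg _ _) (apply_nonneg _ _)
  · intro a
    have key (q : representationSeminorms p) : q.1 (star a * a) = q.1 a ^ 2 := by
      obtain ⟨H, _, _, _, φ, -, h2⟩ := q.2
      rw [h2, h2, map_mul, map_star, CStarRing.norm_star_mul_self, sq]
    refine le_antisymm (hsup _ _ fun q => ?_) ?_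
    · rw [key]
      exact pow_le_pow_left₀ (apply_nonneg _ _) (hle q a) 2
    · have h : envelopingSeminorm p a ≤ √(envelopingSeminorm p (star a * a)) :=
        hsup _ _ fun q => Real.le_sqrt_of_sq_le ((key q).symm.trans_le (hle q _))
      calc envelopingSeminorm p a ^ 2 ≤ √(envelopingSeminorm p (star a * a)) ^ 2 :=
            pow_le_pow_left₀ (apply_nonneg _ _) h 2
        _ = _ := Real.sq_sqrt (apply_nonneg _ _)

/-- The family `{r_p}`, `p ∈ P`. -/
def StarSeminormFamily.enveloping (P : StarSeminormFamily E) : StarSeminormFamily E where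
  carrier := envelopingSeminorm '' P.carrier
  isStarSeminorm := by
    rintro _ ⟨p, -, rfl⟩
    exact (isCStarSeminorm_envelopingSeminorm p).isStarSeminorm

/-- The enveloping locally `C*`-algebra of the complete locally `m`-convex `*`-algebra `E` whose
topology is defined by the directed family `P`: the Hausdorff completion of `E` with respect to the
`C*`-seminorms `r_p`, `p ∈ P`. -/
abbrev EnvelopingAlgebra (P : StarSeminormFamily E) : Type w :=
  P.enveloping.HausdorffCompletion

end Enveloping

/-! ### Locally `C*`-algebras -/

/-- A locally `C*`-algebra: a complete Hausdorff complex topological `*`-algebra whose topology is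
determined by its continuous `C*`-seminorms. -/
class LocallyCStarAlgebra (A : Type*) extends NonUnitalRing A, StarRing A, Module ℂ A,
    IsScalarTower ℂ A A, SMulCommClass ℂ A A, StarModule ℂ A, UniformSpace A,
    IsUniformAddGroup A, ContinuousMul A, ContinuousStar A, ContinuousSMul ℂ A,
    CompleteSpace A, T2Space A where
  withSeminorms : WithSeminorms
    (fun p : {p : Seminorm ℂ A // IsCStarSeminorm p ∧ Continuous p} => p.1)

/-! ### Integrals of vector-valued functions -/

section Integral

variable {G : Type*} [MeasurableSpace G] (μ : Measure G)
variable {A : Type*} [LocallyCStarAlgebra A]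

/-- `a` is the (weak) integral of `f`. -/
def IsVectorIntegral (f : G → A) (a : A) : Prop :=
  ∀ l : A →L[ℂ] ℂ, l a = ∫ s, l (f s) ∂μ

open Classical in
/-- The integral `∫ f(s) dμ(s) ∈ A`. -/
def vectorIntegral (f : G → A) : A :=
  if h : ∃ a, IsVectorIntegral μ f a then h.choose else 0

/-- `A` with the seminorm `p`, and no other topology. -/
def Semi (_p : Seminorm ℂ A) : Type _ := A

instance (p : Seminorm ℂ A) : SeminormedAddCommGroup (Semi p) :=
  p.toSeminormedAddCommGroup

instance (p : Seminorm ℂ A) : Module ℂ (Semi p) := inferInstanceAs (Module ℂ A)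

instance (p : Seminorm ℂ A) : NormedSpace ℂ (Semi p) where
  norm_smul_le c a := (map_smul_eq_mul p c a).le

/-- The canonical map from `A` to its completion `A_p` for the continuous seminorm `p`. -/
def toSemi (p : Seminorm ℂ A) (hp : Continuous p) : A →L[ℂ] UniformSpace.Completion (Semi p) where
  toFun a := UniformSpace.Completion.coe' (α := Semi p) a
  map_add' a b := UniformSpace.Completion.coe_add (α := Semi p) a b
  map_smul' c a := UniformSpace.Completion.coe_smul (X := Semi p) c a
  cont := by
    refine (UniformSpace.Completion.continuous_coe (Semi p)).comp ?_
    let i : A →+ Semi p := AddMonoidHom.id A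
    refine continuous_of_continuousAt_zero i ?_
    rw [ContinuousAt, map_zero, tendsto_zero_iff_norm_tendsto_zero]
    have h := hp.tendsto 0
    rw [map_zero] at h
    exact h

theorem norm_toSemi (p : Seminorm ℂ A) (hp : Continuous p) (a : A) : ‖toSemi p hp a‖ = p a :=
  UniformSpace.Completion.norm_coe (E := Semi p) a

theorem ext_of_functionals {a b : A} (h : ∀ l : A →L[ℂ] ℂ, l a = l b) : a = b := by
  by_contra hab
  obtain ⟨p, hp⟩ := LocallyCStarAlgebra.withSeminorms.separating_of_T1 (a - b) (sub_ne_zero.2 hab)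
  have h1 : toSemi p.1 p.2.2 (a - b) ≠ 0 := by
    rw [← norm_ne_zero_iff, norm_toSemi]
    exact hp
  obtain ⟨l, hl⟩ := SeparatingDual.exists_ne_zero (R := ℂ) h1
  apply hl
  have := h (l.comp (toSemi p.1 p.2.2))
  simpa [sub_eq_zero] using this

theorem IsVectorIntegral.unique {f : G → A} {a b : A} (ha : IsVectorIntegral μ f a)
    (hb : IsVectorIntegral μ f b) : a = b :=
  ext_of_functionals fun l => (ha l).trans (hb l).symm

theorem IsVectorIntegral.eq {f : G → A} {a : A} (ha : IsVectorIntegral μ f a) :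
    vectorIntegral μ f = a := by
  have h : ∃ a, IsVectorIntegral μ f a := ⟨a, ha⟩
  rw [vectorIntegral, dif_pos h]
  exact h.choose_spec.unique μ ha

theorem exists_connecting {p q : Seminorm ℂ A} (hp : Continuous p) (hq : Continuous q)
    (hqp : q ≤ p) : ∃ C : UniformSpace.Completion (Semi p) →L[ℂ] UniformSpace.Completion (Semi q),
      (∀ a, toSemi q hq a = C (toSemi p hp a)) ∧ ∀ x, ‖C x‖ ≤ ‖x‖ := by
  let i : Semi p →ₗ[ℂ] UniformSpace.Completion (Semi q) := (toSemi q hq).toLinearMap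
  let j : Semi p →L[ℂ] UniformSpace.Completion (Semi q) := i.mkContinuous 1 fun a => by
    rw [one_mul]
    exact (norm_toSemi q hq a).trans_le (hqp a)
  let e : Semi p →L[ℂ] UniformSpace.Completion (Semi p) := UniformSpace.Completion.toComplL
  have he : DenseRange e := UniformSpace.Completion.denseRange_coe
  have hi : IsUniformInducing e := UniformSpace.Completion.isUniformInducing_coe _
  have h (a : Semi p) : j.extend e (e a) = j a := j.extend_eq he hi a
  refine ⟨j.extend e, fun a => (h a).symm, fun x => ?_⟩
  refine UniformSpace.Completion.induction_on x (isClosed_le (by fun_prop) (by fun_prop))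
    fun a => ?_
  refine (congrArg norm (h a)).trans_le ?_
  rw [UniformSpace.Completion.norm_coe]
  exact (norm_toSemi q hq a).trans_le (hqp a)

theorem exists_integral_aux {f : G → A}
    (hf : ∀ (p : Seminorm ℂ A) (hp : Continuous p), Integrable (fun s => toSemi p hp (f s)) μ) :
    ∃ a, ∀ (p : Seminorm ℂ A) (hp : Continuous p),
      toSemi p hp a = ∫ s, toSemi p hp (f s) ∂μ := by
  let S := {p : Seminorm ℂ A // Continuous p} × {ε : ℝ // 0 < ε}
  let K : S → Set A := fun x =>
    {a | ‖toSemi x.1.1 x.1.2 a - ∫ s, toSemi x.1.1 x.1.2 (f s) ∂μ‖ < x.2.1}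
  have hK : ∀ x, (K x).Nonempty := by
    rintro ⟨⟨p, hp⟩, ⟨ε, hε⟩⟩
    obtain ⟨a, ha⟩ := (UniformSpace.Completion.denseRange_coe (α := Semi p)).exists_dist_lt
      (∫ s, toSemi p hp (f s) ∂μ) hε
    refine ⟨a, ?_⟩
    rw [dist_comm, dist_eq_norm] at ha
    exact ha
  have hmono : ∀ (p q : Seminorm ℂ A) (hp : Continuous p) (hq : Continuous q), q ≤ p → ∀ a : A,
      ‖toSemi q hq a - ∫ s, toSemi q hq (f s) ∂μ‖ ≤
        ‖toSemi p hp a - ∫ s, toSemi p hp (f s) ∂μ‖ := by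
    intro p q hp hq hqp a
    obtain ⟨C, hC, hn⟩ := exists_connecting hp hq hqp
    have : toSemi q hq a - ∫ s, toSemi q hq (f s) ∂μ =
        C (toSemi p hp a - ∫ s, toSemi p hp (f s) ∂μ) := by
      rw [map_sub, hC, ← C.integral_comp_comm (hf p hp)]
      simp_rw [hC]
    rw [this]
    exact hn _
  have hdir : Directed (· ≥ ·) fun x => 𝓟 (K x) := by
    rintro ⟨⟨p, hp⟩, ⟨ε, hε⟩⟩ ⟨⟨q, hq⟩, ⟨δ, hδ⟩⟩
    have hpq : Continuous (p + q : Seminorm ℂ A) := hp.add hq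
    have h1 : p ≤ p + q := fun a => le_add_of_nonneg_right (apply_nonneg q a)
    have h2 : q ≤ p + q := fun a => le_add_of_nonneg_left (apply_nonneg p a)
    refine ⟨⟨⟨p + q, hpq⟩, ⟨min ε δ, lt_min hε hδ⟩⟩, ?_, ?_⟩
    · exact Filter.principal_mono.2 fun a ha =>
        (hmono _ _ hpq hp h1 a).trans_lt (lt_of_lt_of_le ha (min_le_left _ _))
    · exact Filter.principal_mono.2 fun a ha =>
        (hmono _ _ hpq hq h2 a).trans_lt (lt_of_lt_of_le ha (min_le_right _ _))
  have hne : Nonempty S := ⟨⟨⟨0, continuous_zero⟩, ⟨1, one_pos⟩⟩⟩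
  have hbot : (⨅ x, 𝓟 (K x)).NeBot :=
    Filter.iInf_neBot_of_directed hdir fun x => Filter.principal_neBot_iff.2 (hK x)
  have hmem (x : S) : K x ∈ ⨅ x, 𝓟 (K x) :=
    Filter.mem_iInf_of_mem x (Filter.mem_principal_self _)
  have hcauchy : Cauchy (⨅ x, 𝓟 (K x)) := by
    refine ⟨hbot, ?_⟩
    rw [uniformity_eq_comap_nhds_zero A, ← Filter.tendsto_iff_comap,
      LocallyCStarAlgebra.withSeminorms.tendsto_nhds]
    rintro ⟨p, -, hp⟩ ε hε
    have hm := hmem ⟨⟨p, hp⟩, ⟨ε / 2, half_pos hε⟩⟩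
    filter_upwards [Filter.prod_mem_prod hm hm] with x hx
    have h1 : ‖_‖ < ε / 2 := hx.1
    have h2 : ‖_‖ < ε / 2 := hx.2
    rw [sub_zero]
    change p (x.2 - x.1) < ε
    rw [← norm_toSemi p hp, map_sub, ← sub_sub_sub_cancel_right _ _ (∫ s, toSemi p hp (f s) ∂μ)]
    exact (norm_sub_le _ _).trans_lt (by linarith)
  obtain ⟨a, ha⟩ := CompleteSpace.complete hcauchy
  refine ⟨a, fun p hp => ?_⟩
  refine eq_of_forall_dist_le fun ε hε => ?_
  rw [dist_eq_norm]
  have hcl : IsClosed {b | ‖toSemi p hp b - ∫ s, toSemi p hp (f s) ∂μ‖ ≤ ε} :=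
    isClosed_le (by fun_prop) continuous_const
  refine hcl.mem_of_tendsto (tendsto_id'.2 ha) ?_
  filter_upwards [hmem ⟨⟨p, hp⟩, ⟨ε, hε⟩⟩] with b hb
  exact le_of_lt hb

theorem exists_bound (l : A →L[ℂ] ℂ) : ∃ p : Seminorm ℂ A, ∃ hp : Continuous p,
    ∃ l' : UniformSpace.Completion (Semi p) →L[ℂ] ℂ, ∀ a, l a = l' (toSemi p hp a) := by
  let p : Seminorm ℂ A := (normSeminorm ℂ ℂ).comp l.toLinearMap
  have hp : Continuous p := l.continuous.norm
  let i : Semi p →ₗ[ℂ] ℂ := l.toLinearMap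
  let j : Semi p →L[ℂ] ℂ := i.mkContinuous 1 fun a => by
    rw [one_mul]
    exact le_rfl
  let e : Semi p →L[ℂ] UniformSpace.Completion (Semi p) := UniformSpace.Completion.toComplL
  have he : DenseRange e := UniformSpace.Completion.denseRange_coe
  have hi : IsUniformInducing e := UniformSpace.Completion.isUniformInducing_coe _
  exact ⟨p, hp, j.extend e, fun a => (j.extend_eq he hi a).symm⟩

variable [TopologicalSpace G] [OpensMeasurableSpace G] [IsFiniteMeasureOnCompacts μ]

theorem integrable_toSemi {f : G → A} (hf : Continuous f) (hc : HasCompactSupport f)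
    (p : Seminorm ℂ A) (hp : Continuous p) : Integrable (fun s => toSemi p hp (f s)) μ :=
  ((toSemi p hp).continuous.comp hf).integrable_of_hasCompactSupport
    (hc.comp_left (map_zero (toSemi p hp)))

theorem isVectorIntegral_vectorIntegral {f : G → A} (hf : Continuous f)
    (hc : HasCompactSupport f) : IsVectorIntegral μ f (vectorIntegral μ f) ∧
      ∀ (p : Seminorm ℂ A), Continuous p → p (vectorIntegral μ f) ≤ ∫ s, p (f s) ∂μ := by
  have hi := integrable_toSemi μ hf hc
  obtain ⟨a, ha⟩ := exists_integral_aux μ hi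
  have h : IsVectorIntegral μ f a := by
    intro l
    obtain ⟨p, hp, l', hl⟩ := exists_bound l
    simp_rw [hl]
    rw [ha, ← l'.integral_comp_comm (hi p hp)]
  rw [h.eq]
  refine ⟨h, fun p hp => ?_⟩
  rw [← norm_toSemi p hp, ha]
  refine (norm_integral_le_integral_norm _).trans_eq ?_
  simp_rw [norm_toSemi]

theorem apply_vectorIntegral {f : G → A} (hf : Continuous f) (hc : HasCompactSupport f)
    (l : A →L[ℂ] ℂ) : l (vectorIntegral μ f) = ∫ s, l (f s) ∂μ :=
  (isVectorIntegral_vectorIntegral μ hf hc).1 l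

theorem seminorm_vectorIntegral_le {f : G → A} (hf : Continuous f) (hc : HasCompactSupport f)
    (p : Seminorm ℂ A) (hp : Continuous p) : p (vectorIntegral μ f) ≤ ∫ s, p (f s) ∂μ :=
  (isVectorIntegral_vectorIntegral μ hf hc).2 p hp

end Integral

section Integral

variable {G : Type*} [MeasurableSpace G] (μ : Measure G)
variable {A : Type*} [LocallyCStarAlgebra A]
variable [TopologicalSpace G] [OpensMeasurableSpace G] [IsFiniteMeasureOnCompacts μ]

theorem integrable_functional {f : G → A} (hf : Continuous f) (hc : HasCompactSupport f)
    (l : A →L[ℂ] ℂ) : Integrable (fun s => l (f s)) μ :=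
  (l.continuous.comp hf).integrable_of_hasCompactSupport (hc.comp_left (map_zero l))

theorem vectorIntegral_add {f g : G → A} (hf : Continuous f) (hc : HasCompactSupport f)
    (hg : Continuous g) (hc' : HasCompactSupport g) :
    vectorIntegral μ (fun s => f s + g s) = vectorIntegral μ f + vectorIntegral μ g :=
  IsVectorIntegral.eq μ fun l => by
    simp only [map_add, apply_vectorIntegral μ hf hc, apply_vectorIntegral μ hg hc']
    rw [integral_add (integrable_functional μ hf hc l) (integrable_functional μ hg hc' l)]

theorem map_vectorIntegral (L : A →L[ℂ] A) {f : G → A} (hf : Continuous f)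
    (hc : HasCompactSupport f) :
    vectorIntegral μ (fun s => L (f s)) = L (vectorIntegral μ f) :=
  IsVectorIntegral.eq μ fun l => apply_vectorIntegral μ hf hc (l.comp L)

theorem star_vectorIntegral {f : G → A} (hf : Continuous f) (hc : HasCompactSupport f) :
    vectorIntegral μ (fun s => star (f s)) = star (vectorIntegral μ f) :=
  IsVectorIntegral.eq μ fun l => by
    let l' : A →L[ℂ] ℂ :=
      { toFun a := star (l (star a))
        map_add' a b := by simp
        map_smul' c a := by simp
        cont := by fun_prop }
    have h : star (l (star (vectorIntegral μ f))) = ∫ s, star (l (star (f s))) ∂μ :=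
      apply_vectorIntegral μ hf hc l'
    rw [← star_star (l _), h, ← starRingEnd_apply, ← integral_conj]
    simp

theorem seminorm_vectorIntegral_sub_le {f g : G → A} (hf : Continuous f) (hc : HasCompactSupport f)
    (hg : Continuous g) (hc' : HasCompactSupport g) (p : Seminorm ℂ A) (hp : Continuous p) :
    p (vectorIntegral μ f - vectorIntegral μ g) ≤ ∫ s, p (f s - g s) ∂μ := by
  have h : vectorIntegral μ (fun s => f s - g s) = vectorIntegral μ f - vectorIntegral μ g :=
    IsVectorIntegral.eq μ fun l => by
      simp only [map_sub, apply_vectorIntegral μ hf hc, apply_vectorIntegral μ hg hc']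
      rw [integral_sub (integrable_functional μ hf hc l) (integrable_functional μ hg hc' l)]
  rw [← h]
  exact seminorm_vectorIntegral_le μ (hf.sub hg) (hc.sub hc') p hp

variable {X : Type*} [TopologicalSpace X]

theorem continuous_vectorIntegral [T2Space G] {k : X → G → A} (hk : Continuous k.uncurry)
    {K : Set G} (hK : IsCompact K) (h0 : ∀ x, ∀ t ∉ K, k x t = 0) :
    Continuous fun x => vectorIntegral μ (k x) := by
  have hc (x : X) : Continuous (k x) := hk.comp (Continuous.prodMk_right x)
  have hs (x : X) : HasCompactSupport (k x) := HasCompactSupport.intro hK (h0 x)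
  rw [continuous_iff_continuousAt]
  intro x₀
  rw [ContinuousAt, LocallyCStarAlgebra.withSeminorms.tendsto_nhds]
  rintro ⟨p, -, hp⟩ ε hε
  have hφ : Continuous fun x => ∫ t, p (k x t - k x₀ t) ∂μ := by
    rw [← continuousOn_univ]
    refine continuousOn_integral_of_compact_support hK (Continuous.continuousOn ?_) ?_
    · exact hp.comp (hk.sub ((hc x₀).comp continuous_snd))
    · intro x t _ ht
      rw [h0 _ _ ht, h0 _ _ ht, sub_zero, map_zero]
  have hlim := hφ.tendsto x₀
  simp only [sub_self, map_zero, integral_zero] at hlim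
  filter_upwards [hlim.eventually_lt_const hε] with x hx
  exact (seminorm_vectorIntegral_sub_le μ (hc x) (hs x) (hc x₀) (hs x₀) p hp).trans_lt hx

theorem exists_compact_of_hasCompactSupport {Y Z M : Type*} [Zero M] [TopologicalSpace Y]
    [TopologicalSpace Z] {k : Y → Z → M} (hs : HasCompactSupport k.uncurry) :
    ∃ K : Set Y, ∃ L : Set Z, IsCompact K ∧ IsCompact L ∧ (∀ y ∉ K, ∀ z, k y z = 0) ∧
      ∀ z ∉ L, ∀ y, k y z = 0 := by
  refine ⟨Prod.fst '' tsupport k.uncurry, Prod.snd '' tsupport k.uncurry,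
    IsCompact.image hs continuous_fst, IsCompact.image hs continuous_snd, ?_, ?_⟩
  · intro y hy z
    by_contra h
    exact hy ⟨(y, z), subset_tsupport _ h, rfl⟩
  · intro z hz y
    by_contra h
    exact hz ⟨(y, z), subset_tsupport _ h, rfl⟩

variable [T2Space G]

theorem vectorIntegral_swap {k : G → G → A} (hk : Continuous k.uncurry)
    (hs : HasCompactSupport k.uncurry) :
    vectorIntegral μ (fun s => vectorIntegral μ (k s)) =
      vectorIntegral μ (fun t => vectorIntegral μ fun s => k s t) := by
  obtain ⟨K, L, hK, hL, h1, h2⟩ := exists_compact_of_hasCompactSupport hs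
  have hk' : Continuous (fun t s => k s t).uncurry := hk.comp continuous_swap
  have e0 : vectorIntegral μ (fun _ : G => (0 : A)) = 0 :=
    IsVectorIntegral.eq μ fun l => by simp
  have c1 : Continuous fun s => vectorIntegral μ (k s) :=
    continuous_vectorIntegral μ hk hL fun s t ht => h2 t ht s
  have c2 : Continuous fun t => vectorIntegral μ fun s => k s t :=
    continuous_vectorIntegral μ hk' hK fun t s hs => h1 s hs t
  have s1 : HasCompactSupport fun s => vectorIntegral μ (k s) :=
    HasCompactSupport.intro hK fun s hs => by
      rw [show k s = fun _ => 0 from funext (h1 s hs), e0]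
  have s2 : HasCompactSupport fun t => vectorIntegral μ fun s => k s t :=
    HasCompactSupport.intro hL fun t ht => by simp only [h2 t ht, e0]
  refine ext_of_functionals fun l => ?_
  rw [apply_vectorIntegral μ c1 s1, apply_vectorIntegral μ c2 s2]
  have e1 (s : G) : l (vectorIntegral μ (k s)) = ∫ t, l (k s t) ∂μ :=
    apply_vectorIntegral μ (hk.comp (Continuous.prodMk_right s))
      (HasCompactSupport.intro hL fun t ht => h2 t ht s) l
  have e2 (t : G) : l (vectorIntegral μ fun s => k s t) = ∫ s, l (k s t) ∂μ :=
    apply_vectorIntegral μ (hk'.comp (Continuous.prodMk_right t))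
      (HasCompactSupport.intro hK fun s hs => h1 s hs t) l
  simp only [e1, e2]
  exact integral_integral_swap_of_hasCompactSupport (f := fun s t => l (k s t))
    (l.continuous.comp hk) (hs.comp_left (map_zero l))

theorem integrable_integral {k : G → G → ℝ} (hk : Continuous k.uncurry)
    (hs : HasCompactSupport k.uncurry) : Integrable (fun s => ∫ t, k s t ∂μ) μ := by
  obtain ⟨K, L, hK, hL, h1, h2⟩ := exists_compact_of_hasCompactSupport hs
  refine Continuous.integrable_of_hasCompactSupport ?_
    (HasCompactSupport.intro hK fun s hs => by simp only [h1 s hs, integral_zero])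
  rw [← continuousOn_univ]
  exact continuousOn_integral_of_compact_support hL hk.continuousOn fun s t _ ht => h2 t ht s

end Integral

/-! ### The modular function -/

section Modular

variable {G : Type*} [Group G] [TopologicalSpace G] [IsTopologicalGroup G] [LocallyCompactSpace G]

/-- The inverse `γ(t)⁻¹` of the modular function `γ` of `G`, where `μ(E t) = γ(t) μ(E)` for a left
Haar measure `μ`. -/
def modularInv (t : G) : ℝ := (Measure.modularCharacter t : ℝ≥0)

theorem modularInv_mul (s t : G) : modularInv (s * t) = modularInv s * modularInv t := by
  simp [modularInv]

theorem modularInv_nonneg (t : G) : 0 ≤ modularInv t := NNReal.coe_nonneg _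

theorem modularInv_one : modularInv (1 : G) = 1 := by
  simp [modularInv]

variable [MeasurableSpace G] [BorelSpace G] (μ : Measure G) [μ.IsHaarMeasure]

theorem integral_mul_right_modularInv (f : G → ℝ) (hf : Continuous f) (hc : HasCompactSupport f) (t : G) :
    ∫ s, f (s * t) ∂μ = modularInv t * ∫ s, f s ∂μ := by
  have h1 : modularInv t = Measure.haarScalarFactor (Measure.map (· * t) μ) μ :=
    congrArg NNReal.toReal (Measure.modularCharacterFun_eq_haarScalarFactor μ t)
  have h2 := Measure.integral_isMulLeftInvariant_eq_smul_of_hasCompactSupport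
    (Measure.map (· * t) μ) μ hf hc
  rw [integral_map (by fun_prop) hf.aestronglyMeasurable, integral_smul_nnreal_measure] at h2
  rw [h1, h2]
  rfl

theorem continuous_modularInv [T2Space G] : Continuous (modularInv : G → ℝ) := by
  let ν : Measure G := Measure.haar
  obtain ⟨⟨f, hf⟩, hc, f_nonneg, f_one⟩ :
    ∃ f : C(G, ℝ), HasCompactSupport f ∧ 0 ≤ f ∧ f 1 ≠ 0 := exists_continuous_nonneg_pos 1
  have hpos : 0 < ∫ s, f s ∂ν :=
    hf.integral_pos_of_hasCompactSupport_nonneg_nonzero hc f_nonneg f_one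
  have h (t : G) : modularInv t = (∫ s, f (s * t) ∂ν) / ∫ s, f s ∂ν := by
    rw [integral_mul_right_modularInv ν f hf hc t, mul_div_cancel_right₀ _ hpos.ne']
  have hfun : (modularInv : G → ℝ) = fun t => (∫ s, f (s * t) ∂ν) / ∫ s, f s ∂ν := funext h
  rw [hfun]
  refine Continuous.div_const ?_ _
  rw [continuous_iff_continuousAt]
  intro t₀
  obtain ⟨U, hU, hUn⟩ := exists_compact_mem_nhds t₀
  refine ContinuousOn.continuousAt ?_ hUn
  refine continuousOn_integral_of_compact_support (IsCompact.mul hc hU.inv)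
    (Continuous.continuousOn ?_) ?_
  · exact hf.comp (continuous_snd.mul continuous_fst)
  · intro t s ht hs
    by_contra hne
    exact hs ⟨s * t, subset_tsupport _ hne, t⁻¹, Set.inv_mem_inv.2 ht, by simp⟩

theorem integral_inv_modularInv [T2Space G] (f : G → ℝ) (hf : Continuous f)
    (hc : HasCompactSupport f) :
    ∫ s, modularInv s * f s⁻¹ ∂μ = ∫ s, f s ∂μ := by
  obtain ⟨⟨g, hg⟩, gc, g_nonneg, g_one⟩ :
    ∃ g : C(G, ℝ), HasCompactSupport g ∧ 0 ≤ g ∧ g 1 ≠ 0 := exists_continuous_nonneg_pos 1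
  have hpos : 0 < ∫ s, g s ∂μ :=
    hg.integral_pos_of_hasCompactSupport_nonneg_nonzero gc g_nonneg g_one
  simp only [ContinuousMap.coe_mk] at gc
  refine mul_right_cancel₀ hpos.ne' ?_
  have hs1 : HasCompactSupport (fun x y => f x⁻¹ * g (y * x) : G → G → ℝ).uncurry := by
    refine HasCompactSupport.intro (K := (fun z : G × G => (z.1⁻¹, z.2 * z.1)) ''
      (tsupport f ×ˢ tsupport g)) ((IsCompact.prod hc gc).image (by fun_prop)) ?_
    rintro ⟨x, y⟩ hxy
    by_contra hne
    refine hxy ⟨(x⁻¹, y * x), ⟨subset_tsupport _ (left_ne_zero_of_mul hne),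
      subset_tsupport _ (right_ne_zero_of_mul hne)⟩, by simp⟩
  have hs2 : HasCompactSupport (fun y x => f (x⁻¹ * y) * g x : G → G → ℝ).uncurry := by
    refine HasCompactSupport.intro (K := (fun z : G × G => (z.2 * z.1, z.2)) ''
      (tsupport f ×ˢ tsupport g)) ((IsCompact.prod hc gc).image (by fun_prop)) ?_
    rintro ⟨y, x⟩ hxy
    by_contra hne
    refine hxy ⟨(x⁻¹ * y, x), ⟨subset_tsupport _ (left_ne_zero_of_mul hne),
      subset_tsupport _ (right_ne_zero_of_mul hne)⟩, by simp⟩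
  calc (∫ s, modularInv s * f s⁻¹ ∂μ) * ∫ s, g s ∂μ
      = ∫ x, (∫ y, f x⁻¹ * g (y * x) ∂μ) ∂μ := by
        rw [← MeasureTheory.integral_mul_const]
        refine integral_congr_ae (Eventually.of_forall fun x => ?_)
        simp only
        rw [integral_const_mul, integral_mul_right_modularInv μ g hg gc]
        ring
    _ = ∫ y, (∫ x, f x⁻¹ * g (y * x) ∂μ) ∂μ :=
        integral_integral_swap_of_hasCompactSupport
          ((hf.comp continuous_fst.inv).mul (hg.comp (continuous_snd.mul continuous_fst))) hs1
    _ = ∫ y, (∫ x, f (x⁻¹ * y) * g x ∂μ) ∂μ := by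
        refine integral_congr_ae (Eventually.of_forall fun y => ?_)
        simp only
        rw [← integral_mul_left_eq_self (fun x => f (x⁻¹ * y) * g x) y]
        simp
    _ = ∫ x, (∫ y, f (x⁻¹ * y) * g x ∂μ) ∂μ :=
        integral_integral_swap_of_hasCompactSupport
          ((hf.comp (continuous_snd.inv.mul continuous_fst)).mul (hg.comp continuous_snd)) hs2
    _ = (∫ s, f s ∂μ) * ∫ s, g s ∂μ := by
        rw [← integral_const_mul]
        refine integral_congr_ae (Eventually.of_forall fun x => ?_)
        simp only
        rw [MeasureTheory.integral_mul_const, integral_mul_left_eq_self]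

end Modular

/-! ### Actions -/

/-- A continuous action of `G` on `A` by automorphisms of the locally `C*`-algebra `A`. Each
`α t` is a homeomorphism by joint continuity. -/
structure ContinuousAction (G A : Type*) [Group G] [TopologicalSpace G]
    [LocallyCStarAlgebra A] where
  toHom : G →* (A ≃⋆ₐ[ℂ] A)
  continuous_uncurry : Continuous fun x : G × A => toHom x.1 x.2

section Action

universe v

variable {G : Type*} [Group G] [TopologicalSpace G] {A : Type v} [LocallyCStarAlgebra A]

namespace ContinuousAction

instance : CoeFun (ContinuousAction G A) fun _ => G → (A ≃⋆ₐ[ℂ] A) := ⟨fun α => α.toHom⟩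

variable (α : ContinuousAction G A)

theorem continuous_apply {X : Type*} [TopologicalSpace X] {f : X → G} {g : X → A}
    (hf : Continuous f) (hg : Continuous g) : Continuous fun x => α (f x) (g x) :=
  α.continuous_uncurry.comp (hf.prodMk hg)

theorem mul_apply (s t : G) (a : A) : α (s * t) a = α s (α t a) := by
  rw [map_mul, StarAlgEquiv.mul_apply]

theorem one_apply (a : A) : α 1 a = a := by
  rw [map_one, StarAlgEquiv.one_apply]

/-- `α` is an inverse limit action: `A` is the limit of an inverse system `(B δ)` of `C*`-algebras
indexed by a directed set, with connecting maps `κ` and canonical projections `π δ`, and `α t` is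
the limit of the automorphisms `β δ t` for actions `β δ` of `G` on `B δ`. -/
def IsInverseLimitAction : Prop :=
  ∃ (Δ : Type v) (_ : Preorder Δ) (_ : IsDirectedOrder Δ) (_ : Nonempty Δ)
    (B : Δ → Type v) (_ : ∀ δ, NonUnitalCStarAlgebra (B δ))
    (κ : ∀ δ ε, δ ≤ ε → (B ε →⋆ₙₐ[ℂ] B δ))
    (π : ∀ δ, A →⋆ₙₐ[ℂ] B δ)
    (β : ∀ δ, G →* (B δ ≃⋆ₐ[ℂ] B δ)),
    -- `(B, κ)` is an inverse system
    (∀ δ (b : B δ), κ δ δ le_rfl b = b) ∧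
    (∀ δ ε ζ (h₁ : δ ≤ ε) (h₂ : ε ≤ ζ) (b : B ζ), κ δ ε h₁ (κ ε ζ h₂ b) = κ δ ζ (h₁.trans h₂) b) ∧
    -- `A`, with the projections `π`, is its limit as a `*`-algebra
    (∀ δ ε (h : δ ≤ ε) (a : A), κ δ ε h (π ε a) = π δ a) ∧
    (∀ b : (∀ δ, B δ), (∀ δ ε (h : δ ≤ ε), κ δ ε h (b ε) = b δ) → ∃! a : A, ∀ δ, π δ a = b δ) ∧
    -- and as a topological space
    (UniformSpace.toTopologicalSpace : TopologicalSpace A) =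
      ⨅ δ, TopologicalSpace.induced (π δ) inferInstance ∧
    -- for each `t`, `(β δ t)` is an inverse system of automorphisms, with limit `α t`
    (∀ δ ε (h : δ ≤ ε) (t : G) (b : B ε), κ δ ε h (β ε t b) = β δ t (κ δ ε h b)) ∧
    (∀ δ (t : G) (a : A), π δ (α t a) = β δ t (π δ a))

/-- `p` is a `G`-invariant continuous `C*`-seminorm. -/
structure IsInvariantCStarSeminorm (p : Seminorm ℂ A) : Prop where
  isCStarSeminorm : IsCStarSeminorm p
  continuous : Continuous p
  invariant : ∀ (t : G) (a : A), p (α t a) = p a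

/-- `α t` as a continuous linear map. -/
def toCLM (t : G) : A →L[ℂ] A where
  toFun := α t
  map_add' := map_add _
  map_smul' := map_smul _
  cont := α.continuous_apply continuous_const continuous_id

end ContinuousAction
end Action

/-- Left multiplication by `a` as a continuous linear map. -/
def mulLeftCLM {A : Type*} [LocallyCStarAlgebra A] (a : A) : A →L[ℂ] A where
  toFun b := a * b
  map_add' := mul_add a
  map_smul' c b := mul_smul_comm c a b
  cont := continuous_const_mul a

/-- Right multiplication by `a` as a continuous linear map. -/
def mulRightCLM {A : Type*} [LocallyCStarAlgebra A] (a : A) : A →L[ℂ] A where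
  toFun b := b * a
  map_add' b c := add_mul b c a
  map_smul' c b := smul_mul_assoc c b a
  cont := continuous_mul_const a

/-! ### The convolution algebra `C_c(G, A)` -/

section Convolution

variable {G : Type*} [Group G] [TopologicalSpace G] [IsTopologicalGroup G] [LocallyCompactSpace G]
  [T2Space G] [MeasurableSpace G] [BorelSpace G] {A : Type*} [LocallyCStarAlgebra A]

/-- The space `C_c(G, A)` of continuous functions with compact support, which will carry the
convolution product and the involution defined by `α` and the Haar measure `μ`. -/
def ConvAlgebra (_α : ContinuousAction G A) (_μ : Measure G) : Type _ := C_c(G, A)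

namespace ConvAlgebra

variable (α : ContinuousAction G A) (μ : Measure G)

instance : AddCommGroup (ConvAlgebra α μ) := inferInstanceAs (AddCommGroup C_c(G, A))
instance : Module ℂ (ConvAlgebra α μ) := inferInstanceAs (Module ℂ C_c(G, A))
instance : FunLike (ConvAlgebra α μ) G A := inferInstanceAs (FunLike C_c(G, A) G A)

variable {α μ}

@[ext]
theorem ext {f g : ConvAlgebra α μ} (h : ∀ s, f s = g s) : f = g := DFunLike.ext f g h

protected theorem continuous (f : ConvAlgebra α μ) : Continuous f :=
  (show C_c(G, A) from f).toContinuousMap.continuous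

theorem hasCompactSupport (f : ConvAlgebra α μ) : HasCompactSupport f :=
  CompactlySupportedContinuousMap.hasCompactSupport (f : C_c(G, A))

theorem add_apply (f g : ConvAlgebra α μ) (s : G) : (f + g) s = f s + g s := rfl
theorem smul_apply (c : ℂ) (f : ConvAlgebra α μ) (s : G) : (c • f) s = c • f s := rfl
theorem zero_apply (s : G) : (0 : ConvAlgebra α μ) s = 0 := rfl

/-- The integrand `t ↦ f(t) α_t(h(t⁻¹ s))` of the convolution of `f` and `h` at `s`. -/
def kernel (f h : ConvAlgebra α μ) (s t : G) : A := f t * α t (h (t⁻¹ * s))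

theorem continuous_kernel (f h : ConvAlgebra α μ) : Continuous (kernel f h).uncurry :=
  (f.continuous.comp continuous_snd).mul (α.continuous_apply continuous_snd
    (h.continuous.comp (continuous_snd.inv.mul continuous_fst)))

theorem kernel_eq_zero (f h : ConvAlgebra α μ) (s t : G) (ht : t ∉ tsupport f) :
    kernel f h s t = 0 := by
  rw [kernel, image_eq_zero_of_notMem_tsupport ht, zero_mul]

theorem hasCompactSupport_kernel (f h : ConvAlgebra α μ) :
    HasCompactSupport (kernel f h).uncurry := by
  refine HasCompactSupport.intro (K := (fun z : G × G => (z.1 * z.2, z.1)) ''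
    (tsupport f ×ˢ tsupport h))
    ((IsCompact.prod f.hasCompactSupport h.hasCompactSupport).image (by fun_prop)) ?_
  rintro ⟨s, t⟩ hst
  by_contra hne
  refine hst ⟨(t, t⁻¹ * s), ⟨subset_tsupport _ (left_ne_zero_of_mul hne),
    subset_tsupport _ fun h0 => ?_⟩, by simp⟩
  apply right_ne_zero_of_mul hne
  rw [h0, map_zero]

theorem continuous_kernel_right (f h : ConvAlgebra α μ) (s : G) : Continuous (kernel f h s) :=
  (continuous_kernel f h).comp (Continuous.prodMk_right s)

theorem hasCompactSupport_kernel_right (f h : ConvAlgebra α μ) (s : G) :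
    HasCompactSupport (kernel f h s) :=
  HasCompactSupport.intro f.hasCompactSupport (kernel_eq_zero f h s)

theorem vectorIntegral_zero : vectorIntegral μ (fun _ : G => (0 : A)) = 0 :=
  IsVectorIntegral.eq μ fun l => by simp

variable [μ.IsHaarMeasure]

/-- The convolution `(f × h)(s) = ∫ f(t) α_t(h(t⁻¹ s)) dt`. -/
def convolution (f h : ConvAlgebra α μ) : ConvAlgebra α μ :=
  (⟨⟨fun s => vectorIntegral μ fun t => f t * α t (h (t⁻¹ * s)),
      continuous_vectorIntegral μ (continuous_kernel f h) f.hasCompactSupport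
        (kernel_eq_zero f h)⟩, by
      obtain ⟨K, L, hK, hL, h1, h2⟩ :=
        exists_compact_of_hasCompactSupport (hasCompactSupport_kernel f h)
      refine HasCompactSupport.intro hK fun s hs => ?_
      change vectorIntegral μ (kernel f h s) = 0
      rw [show kernel f h s = fun _ => 0 from funext (h1 s hs), vectorIntegral_zero]⟩ : C_c(G, A))

theorem convolution_apply (f h : ConvAlgebra α μ) (s : G) :
    convolution f h s = vectorIntegral μ (kernel f h s) := rfl

/-- The involution `f♯(t) = γ(t)⁻¹ α_t(f(t⁻¹)*)`. -/
def sharp (f : ConvAlgebra α μ) : ConvAlgebra α μ :=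
  (⟨⟨fun t => (modularInv t : ℂ) • α t (star (f t⁻¹)),
      (Complex.continuous_ofReal.comp continuous_modularInv).smul
        (α.continuous_apply continuous_id (f.continuous.comp continuous_inv).star)⟩, by
      refine HasCompactSupport.intro (f.hasCompactSupport : IsCompact (tsupport f)).inv
        fun t ht => ?_
      have h0 : f t⁻¹ = 0 := image_eq_zero_of_notMem_tsupport ht
      change (modularInv t : ℂ) • α t (star (f t⁻¹)) = 0
      rw [h0, star_zero, map_zero, smul_zero]⟩ : C_c(G, A))

theorem sharp_apply (f : ConvAlgebra α μ) (t : G) :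
    sharp f t = (modularInv t : ℂ) • α t (star (f t⁻¹)) := rfl

instance : Mul (ConvAlgebra α μ) := ⟨convolution⟩
instance : Star (ConvAlgebra α μ) := ⟨sharp⟩

theorem mul_apply (f h : ConvAlgebra α μ) (s : G) :
    (f * h) s = vectorIntegral μ (kernel f h s) := rfl

theorem star_apply (f : ConvAlgebra α μ) (t : G) :
    (star f) t = (modularInv t : ℂ) • α t (star (f t⁻¹)) := rfl

theorem vectorIntegral_translate (F : G → A) (s : G) :
    vectorIntegral μ (fun t => F (s * t)) = vectorIntegral μ F := by
  have h : IsVectorIntegral μ (fun t => F (s * t)) = IsVectorIntegral μ F := by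
    ext a
    refine forall_congr' fun l => ?_
    rw [integral_mul_left_eq_self (fun t => l (F t)) s]
  unfold vectorIntegral
  rw [h]

theorem conv_assoc (f g h : ConvAlgebra α μ) : f * g * h = f * (g * h) := by
  ext s
  let k : G → G → A := fun t u => f u * α u (g (u⁻¹ * t)) * α t (h (t⁻¹ * s))
  have hk : Continuous k.uncurry :=
    (continuous_kernel f g).mul (α.continuous_apply continuous_fst
      (h.continuous.comp (continuous_fst.inv.mul continuous_const)))
  have hs : HasCompactSupport k.uncurry := (hasCompactSupport_kernel f g).mul_right
  have e1 (t : G) : kernel (f * g) h s t = vectorIntegral μ (k t) :=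
    (map_vectorIntegral μ (mulRightCLM (α t (h (t⁻¹ * s)))) (continuous_kernel_right f g t)
      (hasCompactSupport_kernel_right f g t)).symm
  have e2 (u : G) : kernel f (g * h) s u = vectorIntegral μ fun t => k t u := by
    have h1 := map_vectorIntegral μ ((mulLeftCLM (f u)).comp (α.toCLM u))
      (continuous_kernel_right g h (u⁻¹ * s)) (hasCompactSupport_kernel_right g h (u⁻¹ * s))
    refine Eq.trans h1.symm ?_
    rw [← vectorIntegral_translate (fun t => k t u) u]
    congr 1
    funext t
    change f u * α u (g t * α t (h (t⁻¹ * (u⁻¹ * s)))) =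
      f u * α u (g (u⁻¹ * (u * t))) * α (u * t) (h ((u * t)⁻¹ * s))
    rw [map_mul (α u), ← α.mul_apply, mul_assoc, mul_inv_rev, mul_assoc t⁻¹, inv_mul_cancel_left]
  rw [mul_apply, mul_apply, funext e1, funext e2]
  exact vectorIntegral_swap μ hk hs

instance : NonUnitalRing (ConvAlgebra α μ) where
  zero_mul h := by
    ext s
    rw [mul_apply, show kernel 0 h s = fun _ => 0 from funext fun t => zero_mul _,
      vectorIntegral_zero, zero_apply]
  mul_zero f := by
    ext s
    rw [mul_apply, show kernel f 0 s = fun _ => 0 from funext fun t => ?_,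
      vectorIntegral_zero, zero_apply]
    rw [kernel, zero_apply, map_zero, mul_zero]
  left_distrib f g h := by
    ext s
    rw [add_apply, mul_apply, mul_apply, mul_apply,
      ← vectorIntegral_add μ (continuous_kernel_right f g s) (hasCompactSupport_kernel_right f g s)
        (continuous_kernel_right f h s) (hasCompactSupport_kernel_right f h s)]
    congr 1
    funext t
    simp only [kernel, add_apply, map_add, mul_add]
  right_distrib f g h := by
    ext s
    rw [add_apply, mul_apply, mul_apply, mul_apply,
      ← vectorIntegral_add μ (continuous_kernel_right f h s) (hasCompactSupport_kernel_right f h s)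
        (continuous_kernel_right g h s) (hasCompactSupport_kernel_right g h s)]
    congr 1
    funext t
    simp only [kernel, add_apply, add_mul]
  mul_assoc := conv_assoc

theorem sharp_mul (f h : ConvAlgebra α μ) : star (f * h) = star h * star f := by
  ext s
  have h1 := map_vectorIntegral μ ((modularInv s : ℂ) • α.toCLM s)
    (continuous_kernel_right f h s⁻¹).star
    ((hasCompactSupport_kernel_right f h s⁻¹).comp_left (star_zero A))
  rw [star_apply, mul_apply, mul_apply,
    ← star_vectorIntegral μ (continuous_kernel_right f h s⁻¹)
      (hasCompactSupport_kernel_right f h s⁻¹)]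
  refine Eq.trans h1.symm ?_
  rw [← vectorIntegral_translate _ s⁻¹]
  congr 1
  funext t
  change (modularInv s : ℂ) • α s (star (f (s⁻¹ * t) *
      α (s⁻¹ * t) (h ((s⁻¹ * t)⁻¹ * s⁻¹)))) =
    ((modularInv t : ℂ) • α t (star (h t⁻¹))) *
      α t ((modularInv (t⁻¹ * s) : ℂ) • α (t⁻¹ * s) (star (f (t⁻¹ * s)⁻¹)))
  have h2 : (s⁻¹ * t)⁻¹ * s⁻¹ = t⁻¹ := by group
  have h3 : (t⁻¹ * s)⁻¹ = s⁻¹ * t := by group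
  have h4 : modularInv t * modularInv (t⁻¹ * s) = modularInv s := by
    rw [← modularInv_mul, mul_inv_cancel_left]
  rw [h2, h3, ← h4, star_mul, map_mul (α s), ← map_star (α (s⁻¹ * t)), ← α.mul_apply,
    mul_inv_cancel_left, map_smul (α t), ← α.mul_apply, mul_inv_cancel_left, smul_mul_smul_comm,
    Complex.ofReal_mul]

instance : StarRing (ConvAlgebra α μ) where
  star_involutive f := by
    ext t
    have h1 : modularInv t * modularInv t⁻¹ = 1 := by
      rw [← modularInv_mul, mul_inv_cancel, modularInv_one]
    rw [star_apply, star_apply, star_smul, ← map_star (α t⁻¹), star_star, inv_inv, map_smul,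
      ← α.mul_apply, mul_inv_cancel, α.one_apply, smul_smul, Complex.star_def, Complex.conj_ofReal,
      ← Complex.ofReal_mul, h1, Complex.ofReal_one, one_smul]
  star_mul := sharp_mul
  star_add f g := by
    ext t
    rw [add_apply, star_apply, star_apply, star_apply, add_apply, star_add, map_add, smul_add]

instance : StarModule ℂ (ConvAlgebra α μ) where
  star_smul c f := by
    ext t
    rw [smul_apply, star_apply, star_apply, smul_apply, star_smul, map_smul, smul_comm]

instance : IsScalarTower ℂ (ConvAlgebra α μ) (ConvAlgebra α μ) where
  smul_assoc c f h := by
    ext s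
    have h1 := map_vectorIntegral μ (c • ContinuousLinearMap.id ℂ A)
      (continuous_kernel_right f h s) (hasCompactSupport_kernel_right f h s)
    refine Eq.trans ?_ h1
    rw [smul_eq_mul, mul_apply]
    congr 1
    funext t
    exact smul_mul_assoc c (f t) _

instance : SMulCommClass ℂ (ConvAlgebra α μ) (ConvAlgebra α μ) where
  smul_comm c f h := by
    ext s
    have h1 := map_vectorIntegral μ (c • ContinuousLinearMap.id ℂ A)
      (continuous_kernel_right f h s) (hasCompactSupport_kernel_right f h s)
    refine Eq.trans h1.symm ?_
    rw [smul_eq_mul, mul_apply]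
    congr 1
    funext t
    change c • (f t * α t (h (t⁻¹ * s))) = f t * α t (c • h (t⁻¹ * s))
    rw [map_smul, mul_smul_comm]

/-- The seminorm `N_p(f) = ∫ p(f(s)) ds` on `C_c(G, A)`. -/
def seminormL1 (p : Seminorm ℂ A) (hp : Continuous p) : Seminorm ℂ (ConvAlgebra α μ) :=
  have hi (f : ConvAlgebra α μ) : Integrable (fun s => p (f s)) μ :=
    (hp.comp f.continuous).integrable_of_hasCompactSupport
      (f.hasCompactSupport.comp_left (map_zero p))
  Seminorm.of (fun f => ∫ s, p (f s) ∂μ)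
    (fun f g => by
      rw [← integral_add (hi f) (hi g)]
      exact integral_mono (hi (f + g)) ((hi f).add (hi g)) fun s => map_add_le_add p _ _)
    (fun c f => by
      rw [← integral_const_mul]
      exact integral_congr_ae (Eventually.of_forall fun s => map_smul_eq_mul p c (f s)))

theorem seminormL1_apply (p : Seminorm ℂ A) (hp : Continuous p) (f : ConvAlgebra α μ) :
    seminormL1 p hp f = ∫ s, p (f s) ∂μ := rfl

theorem isStarSeminorm_seminormL1 {p : Seminorm ℂ A} (hp : α.IsInvariantCStarSeminorm p) :
    IsStarSeminorm (seminormL1 p hp.continuous : Seminorm ℂ (ConvAlgebra α μ)) := by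
  constructor
  · intro f h
    simp only [seminormL1_apply]
    let k : G → G → ℝ := fun s t => p (f t) * p (h (t⁻¹ * s))
    have hk : Continuous k.uncurry :=
      (hp.continuous.comp (f.continuous.comp continuous_snd)).mul
        (hp.continuous.comp (h.continuous.comp (continuous_snd.inv.mul continuous_fst)))
    have hs : HasCompactSupport k.uncurry := by
      refine HasCompactSupport.intro (K := (fun z : G × G => (z.1 * z.2, z.1)) ''
        (tsupport f ×ˢ tsupport h))
        ((IsCompact.prod f.hasCompactSupport h.hasCompactSupport).image (by fun_prop)) ?_
      rintro ⟨s, t⟩ hst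
      by_contra hne
      refine hst ⟨(t, t⁻¹ * s), ⟨subset_tsupport _ fun h0 => ?_,
        subset_tsupport _ fun h0 => ?_⟩, by simp⟩
      · exact left_ne_zero_of_mul hne (by rw [h0, map_zero])
      · exact right_ne_zero_of_mul hne (by rw [h0, map_zero])
    have hle (s t : G) : p (kernel f h s t) ≤ k s t := by
      refine (hp.isCStarSeminorm.mul_le _ _).trans_eq ?_
      rw [hp.invariant]
    calc ∫ s, p ((f * h) s) ∂μ ≤ ∫ s, ∫ t, k s t ∂μ ∂μ := by
          refine integral_mono_of_nonneg (Eventually.of_forall fun s => apply_nonneg p _)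
            (integrable_integral μ hk hs) (Eventually.of_forall fun s => ?_)
          have h1 : p ((f * h) s) ≤ ∫ t, p (kernel f h s t) ∂μ :=
            seminorm_vectorIntegral_le μ (continuous_kernel_right f h s)
              (hasCompactSupport_kernel_right f h s) p hp.continuous
          refine h1.trans (integral_mono_of_nonneg (Eventually.of_forall fun t => apply_nonneg p _)
            ?_ (Eventually.of_forall (hle s)))
          refine (hk.comp (Continuous.prodMk_right s)).integrable_of_hasCompactSupport
            (HasCompactSupport.intro f.hasCompactSupport fun t ht => ?_)
          simp [k, image_eq_zero_of_notMem_tsupport ht]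
      _ = ∫ t, ∫ s, k s t ∂μ ∂μ := integral_integral_swap_of_hasCompactSupport hk hs
      _ = ∫ t, p (f t) * ∫ s, p (h s) ∂μ ∂μ := by
          refine integral_congr_ae (Eventually.of_forall fun t => ?_)
          simp only [k]
          rw [integral_const_mul, integral_mul_left_eq_self (fun s => p (h s))]
      _ = (∫ s, p (f s) ∂μ) * ∫ s, p (h s) ∂μ := MeasureTheory.integral_mul_const _ _
  · intro f
    simp only [seminormL1_apply]
    rw [← integral_inv_modularInv μ (fun s => p (f s)) (hp.continuous.comp f.continuous)
      (f.hasCompactSupport.comp_left (map_zero p))]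
    refine integral_congr_ae (Eventually.of_forall fun t => ?_)
    simp only
    rw [star_apply, map_smul_eq_mul, hp.invariant, hp.isCStarSeminorm.isStarSeminorm.star_eq,
      Complex.norm_real, Real.norm_of_nonneg (modularInv_nonneg t)]

end ConvAlgebra

variable (α : ContinuousAction G A) (μ : Measure G) [μ.IsHaarMeasure]

/-- The seminorms `N_p` on `C_c(G, A)`, where `p` runs over the `G`-invariant continuous
`C*`-seminorms on `A`. When `α` is an inverse limit action, these `p` determine the topology of
`A`. -/
def familyL1 : StarSeminormFamily (ConvAlgebra α μ) where
  carrier := {N | ∃ (p : Seminorm ℂ A) (hp : α.IsInvariantCStarSeminorm p),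
    N = ConvAlgebra.seminormL1 p hp.continuous}
  isStarSeminorm := by
    rintro _ ⟨p, hp, rfl⟩
    exact ConvAlgebra.isStarSeminorm_seminormL1 hp

/-- `L¹(G, A, α)`: the Hausdorff completion of the `*`-algebra `C_c(G, A)` with respect to the
seminorms `N_p`. -/
abbrev L1Algebra : Type _ := (familyL1 α μ).HausdorffCompletion

/-- The crossed product `A ×_α G`: the enveloping locally `C*`-algebra of `L¹(G, A, α)`, whose
topology is defined by the continuous extensions of the seminorms `N_p`. -/
abbrev CrossedProduct : Type _ :=
  EnvelopingAlgebra (StarSeminormFamily.HausdorffCompletion.family (familyL1 α μ))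

/-- The canonical `*`-homomorphism from the convolution algebra `C_c(G, A)` to `A ×_α G`. -/
def toCrossedProduct : ConvAlgebra α μ →⋆ₙₐ[ℂ] CrossedProduct α μ :=
  (StarSeminormFamily.HausdorffCompletion.of
    (StarSeminormFamily.HausdorffCompletion.family (familyL1 α μ)).enveloping).comp
  (StarSeminormFamily.HausdorffCompletion.of (familyL1 α μ))

end Convolution

/-! ### Representations -/

section Representations

variable (H : Type*) [NormedAddCommGroup H] [InnerProductSpace ℂ H] [CompleteSpace H]

/-- A family of operators `φ` on `H` is non-degenerate if the vectors `φ(a) ξ` span a dense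
subspace of `H`. -/
def IsNondegenerate {H : Type*} [NormedAddCommGroup H] [InnerProductSpace ℂ H] {E : Type*}
    (φ : E → (H →L[ℂ] H)) : Prop :=
  (Submodule.span ℂ {ζ : H | ∃ a ξ, φ a ξ = ζ}).topologicalClosure = ⊤

/-- Non-degenerate (continuous) `*`-representations of a topological `*`-algebra `E` on the
Hilbert space `H`. -/
structure NondegenerateRep (E : Type*) [NonUnitalRing E] [StarRing E] [Module ℂ E]
    [TopologicalSpace E] where
  toHom : E →⋆ₙₐ[ℂ] (H →L[ℂ] H)
  continuous : Continuous toHom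
  nondegenerate : IsNondegenerate toHom

/-- Non-degenerate covariant representations `(φ, u)` of `(G, A, α)` on the Hilbert space `H`: `φ`
is a non-degenerate `*`-representation of `A`, `u` is a (strongly continuous) unitary
representation of `G`, and `φ(α_t(a)) = u_t φ(a) u_t*`. -/
structure NondegenerateCovariantRep {G A : Type*} [Group G] [TopologicalSpace G]
    [LocallyCStarAlgebra A] (α : ContinuousAction G A) where
  rep : NondegenerateRep H A
  u : G →* unitary (H →L[ℂ] H)
  continuous_u : ∀ ξ : H, Continuous fun t => (u t : H →L[ℂ] H) ξ
  covariant : ∀ (t : G) (a : A),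
    rep.toHom (α t a) = (u t : H →L[ℂ] H) * rep.toHom a * star (u t : H →L[ℂ] H)

end Representations

end LocCStar

end

open MeasureTheory LocCStar

/-!
Covariant representations and representations of the crossed product are both compared with
`*`-representations `T` of the convolution algebra `C_c(G, A)` that are bounded by a seminorm `N_p`.

A covariant representation `(φ, u)` has the integrated form `T(f) = ∫ φ(f(t)) u_t dt`. Covariance
makes `p(a) = ‖φ(a)‖` a `G`-invariant continuous `C*`-seminorm, and `‖T(f)‖ ≤ N_p(f)`, so `T` extends
to `L¹(G, A, α)` and then to the crossed product (`exists_rep_crossedProduct`). The second extension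
needs `‖T(x)‖ ≤ r_p(x)` although `r_p` only involves Hilbert spaces in the universe of the algebra;
`norm_le_envelopingSeminorm` copies cyclic subrepresentations into that universe. The pair `(φ, u)`
is recovered from the averages `T(g ⊗ a) = ∫ g(t) φ(a) u_t dt`, because a continuous function is
determined by its averages (`norm_le_of_norm_integral_smul_le`).

Conversely, a representation of the crossed product restricts to a representation `T` of
`C_c(G, A)` with `‖T(f)‖ ≤ C N_p(f)` for some `p`. On the dense span of the vectors `T(f) ξ` one puts
`φ(a) T(f) ξ = T(a · f) ξ` and `u_t T(f) ξ = T(t · f) ξ`, where `(a · f)(s) = a f(s)` and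
`(t · f)(s) = α_t(f(t⁻¹ s))`. The operators `u_t` are isometric since `(t · f)♯ × (t · h) = f♯ × h`.
For `φ(a)`, the identity `f × h = ∫ f(t) · (t · h) dt`, which `T` respects because `C_c(G, A)` with
`N_p` embeds isometrically in `L¹(G, A_p)` (`map_integral_of_norm_le`), gives
`T(g ⊗ a) T(h) ξ = ∫ g(t) T(a · (t · h)) ξ dt`. As `‖T(g ⊗ a)‖ ≤ C p(a) ∫ g` for `g ≥ 0`,
concentrating `g` at the identity yields `‖φ(a)‖ ≤ C p(a)`. The same identity shows that `T` is the
integrated form of `(φ, u)`, and that `φ` is non-degenerate: if `φ(a) η = 0` for all `a`, then `η` is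
orthogonal to all vectors `T(f) T(h) ξ`. No approximate unit is needed.
-/

open scoped InnerProductSpace

namespace LocCStar

/-! ### Representations on Hilbert spaces -/

section Representation

variable {H : Type*} [NormedAddCommGroup H] [InnerProductSpace ℂ H] [CompleteSpace H]
variable {E : Type*} [NonUnitalRing E] [StarRing E] [Module ℂ E]

theorem isNondegenerate_iff (φ : E →⋆ₙₐ[ℂ] (H →L[ℂ] H)) :
    IsNondegenerate φ ↔ ∀ η : H, (∀ a, φ a η = 0) → η = 0 := by
  rw [IsNondegenerate, Submodule.topologicalClosure_eq_top_iff, Submodule.eq_bot_iff]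
  refine forall_congr' fun η => imp_congr_left ?_
  rw [Submodule.mem_orthogonal]
  have adj (a : E) (ξ : H) : ⟪φ a ξ, η⟫_ℂ = ⟪ξ, φ (star a) η⟫_ℂ := by
    rw [map_star, ContinuousLinearMap.star_eq_adjoint, ContinuousLinearMap.adjoint_inner_right]
  constructor
  · intro h a
    have := h _ (Submodule.subset_span ⟨star a, φ a η, rfl⟩)
    rwa [adj, star_star, inner_self_eq_zero] at this
  · intro h v hv
    induction hv using Submodule.span_induction with
    | mem v hv =>
      obtain ⟨a, ξ, rfl⟩ := hv
      rw [adj, h, inner_zero_right]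
    | zero => exact inner_zero_left _
    | add x y _ _ hx hy => rw [inner_add_left, hx, hy, add_zero]
    | smul c x _ hx => rw [inner_smul_left, hx, mul_zero]

/-- Operators defined on a dense subspace, given as the range of `S`, by compatible linear maps
`L r` define a `*`-representation on the whole Hilbert space as soon as they are bounded and
`L (star r)` is formally adjoint to `L r`. -/
theorem exists_starHom_of_denseRange {X : Type*} [AddCommGroup X] [Module ℂ X] {S : X →ₗ[ℂ] H}
    (hS : DenseRange S) (L : E → X →ₗ[ℂ] X) (C : E → ℝ)
    (h_add : ∀ r s x, S (L (r + s) x) = S (L r x) + S (L s x))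
    (h_smul : ∀ (c : ℂ) r x, S (L (c • r) x) = c • S (L r x))
    (h_mul : ∀ r s x, S (L (r * s) x) = S (L r (L s x)))
    (h_star : ∀ r x y, ⟪S (L r x), S y⟫_ℂ = ⟪S x, S (L (star r) y)⟫_ℂ)
    (h_bound : ∀ r x, ‖S (L r x)‖ ≤ C r * ‖S x‖) :
    ∃ φ : E →⋆ₙₐ[ℂ] (H →L[ℂ] H), (∀ r x, φ r (S x) = S (L r x)) ∧
      ∀ r v, ‖φ r v‖ ≤ C r * ‖v‖ := by
  let B (r : E) : H →L[ℂ] H := (S ∘ₗ L r).extendOfNorm S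
  have hB (r : E) (x : X) : B r (S x) = S (L r x) :=
    LinearMap.extendOfNorm_eq hS ⟨C r, h_bound r⟩ x
  have ext {T U : H →L[ℂ] H} (h : ∀ x, T (S x) = U (S x)) : T = U :=
    DFunLike.coe_injective (hS.equalizer T.continuous U.continuous (funext h))
  have add (r s : E) : B (r + s) = B r + B s := ext fun x => by simp [hB, h_add]
  have smul (c : ℂ) (r : E) : B (c • r) = c • B r := ext fun x => by simp [hB, h_smul]
  refine ⟨{ toFun := B
            map_smul' := smul
            map_zero' := by simpa using smul 0 0
            map_add' := add
            map_mul' := fun r s => ext fun x => by simp [hB, h_mul]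
            map_star' := fun r => ?_ }, hB,
          fun r => LinearMap.norm_extendOfNorm_apply_le hS (C r) (h_bound r)⟩
  rw [ContinuousLinearMap.star_eq_adjoint, ContinuousLinearMap.eq_adjoint_iff]
  intro v w
  refine hS.induction_on₂ (p := fun v w => ⟪B (star r) v, w⟫_ℂ = ⟪v, B r w⟫_ℂ)
    (isClosed_eq (by fun_prop) (by fun_prop)) (fun x y => ?_) v w
  rw [hB, hB, h_star, star_star]

end Representation

section Universe

universe w

/-- The Hilbert space obtained from a complex vector space `E` by pulling back the inner product of
`H` along a linear map; it lies in the universe of `E`, whatever the universe of `H`. -/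
theorem exists_hilbertSpace_of_linearMap {E : Type w} [AddCommGroup E] [Module ℂ E] {H : Type*}
    [NormedAddCommGroup H] [InnerProductSpace ℂ H] (f : E →ₗ[ℂ] H) :
    ∃ (K : Type w) (_ : NormedAddCommGroup K) (_ : InnerProductSpace ℂ K) (_ : CompleteSpace K)
      (S : E →ₗ[ℂ] K), DenseRange S ∧ ∀ a b, ⟪S a, S b⟫_ℂ = ⟪f a, f b⟫_ℂ := by
  let core : PreInnerProductSpace.Core ℂ E :=
    { inner a b := ⟪f a, f b⟫_ℂ
      conj_inner_symm a b := inner_conj_symm _ _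
      re_inner_nonneg a := inner_self_nonneg
      add_left a b c := by rw [map_add, inner_add_left]
      smul_left a b c := by rw [map_smul, inner_smul_left] }
  let _ : SeminormedAddCommGroup E := InnerProductSpace.Core.toSeminormedAddCommGroup (c := core)
  let _ : InnerProductSpace ℂ E := InnerProductSpace.ofCore core
  refine ⟨UniformSpace.Completion E, inferInstance, inferInstance, inferInstance,
    (UniformSpace.Completion.toComplL : E →L[ℂ] UniformSpace.Completion E).toLinearMap,
    UniformSpace.Completion.denseRange_coe, fun a b => ?_⟩
  exact UniformSpace.Completion.inner_coe a b

/-- A `*`-representation bounded by `p` on a Hilbert space of any universe is bounded by `r_p`,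
although `r_p` is a supremum over Hilbert spaces in the universe of `E` only: the cyclic
subrepresentations have copies in that universe, and they determine the norm. -/
theorem norm_le_envelopingSeminorm {E : Type w} [NonUnitalRing E] [StarRing E] [Module ℂ E]
    [IsScalarTower ℂ E E] [SMulCommClass ℂ E E]
    {H : Type*} [NormedAddCommGroup H] [InnerProductSpace ℂ H] [CompleteSpace H]
    {p : Seminorm ℂ E} (φ : E →⋆ₙₐ[ℂ] (H →L[ℂ] H)) (hφ : ∀ x, ‖φ x‖ ≤ p x) (x : E) :
    ‖φ x‖ ≤ envelopingSeminorm p x := by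
  have cyclic (ξ : H) (y : E) : ‖φ x (φ y ξ)‖ ≤ envelopingSeminorm p x * ‖φ y ξ‖ := by
    let f : E →ₗ[ℂ] H :=
      { toFun a := φ a ξ
        map_add' a b := by simp
        map_smul' c a := by simp }
    obtain ⟨K, _, _, _, S, hS, hin⟩ := exists_hilbertSpace_of_linearMap f
    have hnorm (a : E) : ‖S a‖ = ‖φ a ξ‖ := by
      rw [@norm_eq_sqrt_re_inner ℂ, @norm_eq_sqrt_re_inner ℂ, hin]
      rfl
    have hmul (a b : E) : ‖S (a * b)‖ ≤ ‖φ a‖ * ‖S b‖ := by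
      rw [hnorm, hnorm, map_mul]
      exact (φ a).le_opNorm _
    obtain ⟨ψ, hψ, hb⟩ := exists_starHom_of_denseRange hS (fun a => LinearMap.mulLeft ℂ a)
      (fun a => ‖φ a‖) (fun a b c => by simp [add_mul]) (fun c a b => by simp [smul_mul_assoc])
      (fun a b c => by simp) (fun a b c => by
        rw [hin, hin]
        simp only [f, LinearMap.mulLeft_apply, LinearMap.coe_mk, AddHom.coe_mk, map_mul, map_star]
        exact (ContinuousLinearMap.adjoint_inner_right (φ a) _ _).symm)
      (fun a b => hmul a b)
    have hle (a : E) : ‖ψ a‖ ≤ p a :=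
      ((ψ a).opNorm_le_bound (norm_nonneg _) (hb a)).trans (hφ a)
    let q : Seminorm ℂ E := (normSeminorm ℂ (K →L[ℂ] K)).comp
      (ψ : E →ₗ[ℂ] (K →L[ℂ] K))
    have hq : q x ≤ envelopingSeminorm p x :=
      le_csSup (bddAbove_representationSeminorms p) ⟨K, _, _, _, ψ, hle, fun _ => rfl⟩ x
    calc ‖φ x (φ y ξ)‖ = ‖ψ x (S y)‖ := by
          rw [hψ, hnorm, LinearMap.mulLeft_apply, map_mul]
          rfl
      _ ≤ ‖ψ x‖ * ‖S y‖ := (ψ x).le_opNorm _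
      _ ≤ _ := by
          rw [hnorm]
          exact mul_le_mul_of_nonneg_right hq (norm_nonneg _)
  have h1 : ‖φ x * star (φ x)‖ ≤ envelopingSeminorm p x * ‖φ x‖ := by
    refine ContinuousLinearMap.opNorm_le_bound _ (by positivity) fun ξ => ?_
    rw [← map_star]
    refine (cyclic ξ (star x)).trans ?_
    rw [mul_assoc]
    refine mul_le_mul_of_nonneg_left ?_ (apply_nonneg _ _)
    rw [← norm_star (φ x), ← map_star]
    exact (φ (star x)).le_opNorm ξ
  rw [CStarRing.norm_self_mul_star] at h1
  rcases (norm_nonneg (φ x)).eq_or_lt with h | h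
  · rw [← h]
    exact apply_nonneg _ _
  · exact le_of_mul_le_mul_right h1 h

end Universe

/-! ### Extension to Hausdorff completions -/

namespace StarSeminormFamily.HausdorffCompletion

variable {E : Type*} [NonUnitalRing E] [StarRing E] [Module ℂ E] (P : StarSeminormFamily E)
variable {B : Type*} [NonUnitalNormedRing B] [StarRing B] [CStarRing B] [NormedSpace ℂ B]
  [CompleteSpace B]

theorem exists_starHom_extension (φ : E →⋆ₙₐ[ℂ] B) (p : P.carrier) (hφ : ∀ x, ‖φ x‖ ≤ p.1 x) :
    ∃ ψ : P.HausdorffCompletion →⋆ₙₐ[ℂ] B, Continuous ψ ∧ (∀ x, ψ (mk P x) = φ x) ∧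
      ∀ y, ‖ψ y‖ ≤ extend P p y := by
  let φ' : P.Carrier →+ B := { toFun := φ, map_zero' := map_zero φ, map_add' := map_add φ }
  have hu : UniformContinuous φ' := by
    refine uniformContinuous_of_continuousAt_zero φ' ?_
    rw [ContinuousAt, map_zero]
    refine squeeze_zero_norm (fun x => hφ x) ?_
    have := (P.continuous_seminorm p).tendsto 0
    rwa [map_zero] at this
  let ψ : P.HausdorffCompletion → B := UniformSpace.Completion.extension φ'
  have hc : Continuous ψ := UniformSpace.Completion.continuous_extension
  have hmk (x : E) : ψ (mk P x) = φ x := UniformSpace.Completion.extension_coe hu x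
  have smul (c : ℂ) (x : P.HausdorffCompletion) : ψ (c • x) = c • ψ x := by
    refine induction_on x (isClosed_eq (hc.comp (continuous_const_smul c)) (hc.const_smul c))
      fun a => ?_
    rw [← mk_smul, hmk, hmk, map_smul]
  refine ⟨{ toFun := ψ
            map_smul' := smul
            map_zero' := by rw [← mk_zero, hmk, map_zero]
            map_add' := fun x y => ?_
            map_mul' := fun x y => ?_
            map_star' := fun x => ?_ }, hc, hmk, fun y => ?_⟩
  · refine induction_on x (isClosed_eq (by fun_prop) (by fun_prop)) fun a => ?_
    refine induction_on y (isClosed_eq (by fun_prop) (by fun_prop)) fun b => ?_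
    rw [← mk_add, hmk, hmk, hmk, map_add]
  · refine induction_on x (isClosed_eq (by fun_prop) (by fun_prop)) fun a => ?_
    refine induction_on y (isClosed_eq (by fun_prop) (by fun_prop)) fun b => ?_
    rw [← mk_mul, hmk, hmk, hmk, map_mul]
  · refine induction_on x (isClosed_eq (by fun_prop) (by fun_prop)) fun a => ?_
    rw [← mk_star, hmk, hmk, map_star]
  · refine induction_on y (isClosed_le hc.norm (continuous_extend P p)) fun a => ?_
    rw [extend_mk]
    exact (congrArg norm (hmk a)).trans_le (hφ a)

end StarSeminormFamily.HausdorffCompletion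

end LocCStar

namespace LocCStar

/-! ### Integrals over the group -/

section Integrals

/-- A continuous function is bounded by `M` as soon as its averages against nonnegative functions
with compact support are; concentrating the weight near `t₀` recovers the value at `t₀`. -/
theorem norm_le_of_norm_integral_smul_le {G : Type*} [TopologicalSpace G] [LocallyCompactSpace G]
    [T2Space G] [MeasurableSpace G] [BorelSpace G] (μ : Measure G) [IsFiniteMeasureOnCompacts μ]
    [μ.IsOpenPosMeasure] {W : Type*} [NormedAddCommGroup W] [NormedSpace ℂ W] [CompleteSpace W]
    {F : G → W} (hF : Continuous F) {M : ℝ}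
    (h : ∀ g : G → ℝ, Continuous g → HasCompactSupport g → (∀ t, 0 ≤ g t) →
      ‖∫ t, (g t : ℂ) • F t ∂μ‖ ≤ M * ∫ t, g t ∂μ) (t₀ : G) : ‖F t₀‖ ≤ M := by
  refine le_of_forall_pos_le_add fun ε hε => ?_
  have hU : IsOpen {t | ‖F t - F t₀‖ < ε} :=
    isOpen_lt ((hF.sub continuous_const).norm) continuous_const
  obtain ⟨g, hg1, hg0, hgc, hg01⟩ := exists_continuous_one_zero_of_isCompact
    (isCompact_singleton (x := t₀)) hU.isClosed_compl
    (Set.disjoint_singleton_left.2 fun h => h (by simpa using hε))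
  have hnn (t : G) : 0 ≤ g t := (hg01 t).1
  have hpos : 0 < ∫ t, g t ∂μ :=
    g.continuous.integral_pos_of_hasCompactSupport_nonneg_nonzero hgc hnn
      (x := t₀) (by rw [hg1 rfl]; exact one_ne_zero)
  have hgi : Integrable g μ := g.continuous.integrable_of_hasCompactSupport hgc
  have hgc' : HasCompactSupport fun t => (g t : ℂ) := hgc.comp_left Complex.ofReal_zero
  have hcont : Continuous fun t => (g t : ℂ) := Complex.continuous_ofReal.comp g.continuous
  have hi1 : Integrable (fun t => (g t : ℂ) • F t) μ :=
    (hcont.smul hF).integrable_of_hasCompactSupport hgc'.smul_right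
  have hi2 : Integrable (fun t => (g t : ℂ) • F t₀) μ :=
    (hcont.smul continuous_const).integrable_of_hasCompactSupport hgc'.smul_right
  have hdiff : ‖∫ t, (g t : ℂ) • F t₀ ∂μ - ∫ t, (g t : ℂ) • F t ∂μ‖ ≤ ∫ t, ε * g t ∂μ := by
    rw [← integral_sub hi2 hi1]
    refine norm_integral_le_of_norm_le (hgi.const_mul ε) (Eventually.of_forall fun t => ?_)
    rw [← smul_sub, norm_smul, Complex.norm_real, Real.norm_of_nonneg (hnn t), mul_comm]
    by_cases ht : ‖F t - F t₀‖ < ε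
    · rw [norm_sub_rev]
      exact mul_le_mul_of_nonneg_right ht.le (hnn t)
    · rw [hg0 ht]
      simp
  have hval : ‖∫ t, (g t : ℂ) • F t₀ ∂μ‖ = (∫ t, g t ∂μ) * ‖F t₀‖ := by
    rw [integral_smul_const, norm_smul, integral_complex_ofReal, Complex.norm_real,
      Real.norm_of_nonneg hpos.le]
  rw [integral_const_mul] at hdiff
  have h1 := h g g.continuous hgc hnn
  have h2 := norm_sub_norm_le (∫ t, (g t : ℂ) • F t₀ ∂μ) (∫ t, (g t : ℂ) • F t ∂μ)
  rw [hval] at h2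
  refine le_of_mul_le_mul_left ?_ hpos
  linarith

theorem eq_zero_of_integral_smul_eq_zero {G : Type*} [TopologicalSpace G] [LocallyCompactSpace G]
    [T2Space G] [MeasurableSpace G] [BorelSpace G] (μ : Measure G) [IsFiniteMeasureOnCompacts μ]
    [μ.IsOpenPosMeasure] {W : Type*} [NormedAddCommGroup W] [NormedSpace ℂ W] [CompleteSpace W]
    {F : G → W} (hF : Continuous F)
    (h : ∀ g : G → ℝ, Continuous g → HasCompactSupport g → ∫ t, (g t : ℂ) • F t ∂μ = 0) (t : G) :
    F t = 0 :=
  norm_le_zero_iff.1 <| norm_le_of_norm_integral_smul_le μ hF (fun g hg hgc _ => by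
    rw [h g hg hgc, norm_zero, zero_mul]) t

variable {G : Type*} [Group G] [TopologicalSpace G] [IsTopologicalGroup G] [LocallyCompactSpace G]
  [MeasurableSpace G] [BorelSpace G] (μ : Measure G) [μ.IsHaarMeasure]

theorem integral_mul_right_modularInv_complex {f : G → ℂ} (hf : Continuous f)
    (hc : HasCompactSupport f) (t : G) :
    ∫ s, f (s * t) ∂μ = (modularInv t : ℂ) * ∫ s, f s ∂μ := by
  have hct : HasCompactSupport fun s => f (s * t) :=
    hc.comp_homeomorph (Homeomorph.mulRight t)
  have hcont : Continuous fun s => f (s * t) := hf.comp (continuous_mul_const t)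
  have hi1 := hcont.integrable_of_hasCompactSupport (μ := μ) hct
  have hi2 := hf.integrable_of_hasCompactSupport (μ := μ) hc
  have hre := integral_mul_right_modularInv μ (fun s => (f s).re)
    (Complex.continuous_re.comp hf) (hc.comp_left Complex.zero_re) t
  have him := integral_mul_right_modularInv μ (fun s => (f s).im)
    (Complex.continuous_im.comp hf) (hc.comp_left Complex.zero_im) t
  have e1 := integral_re_add_im hi1
  have e2 := integral_re_add_im hi2
  simp only [Complex.coe_algebraMap, RCLike.re_eq_complex_re,
    RCLike.im_eq_complex_im, RCLike.I_to_complex] at e1 e2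
  rw [← e1, ← e2, hre, him]
  push_cast
  ring

theorem integral_inv_modularInv_complex [T2Space G] {f : G → ℂ} (hf : Continuous f)
    (hc : HasCompactSupport f) :
    ∫ s, (modularInv s : ℂ) * f s⁻¹ ∂μ = ∫ s, f s ∂μ := by
  have hct : HasCompactSupport fun s => (modularInv s : ℂ) * f s⁻¹ :=
    (hc.comp_homeomorph (Homeomorph.inv G)).mul_left
  have hcont : Continuous fun s => (modularInv s : ℂ) * f s⁻¹ :=
    (Complex.continuous_ofReal.comp continuous_modularInv).mul (hf.comp continuous_inv)
  have hi1 := hcont.integrable_of_hasCompactSupport (μ := μ) hct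
  have hi2 := hf.integrable_of_hasCompactSupport (μ := μ) hc
  have hre := integral_inv_modularInv μ (fun s => (f s).re)
    (Complex.continuous_re.comp hf) (hc.comp_left Complex.zero_re)
  have him := integral_inv_modularInv μ (fun s => (f s).im)
    (Complex.continuous_im.comp hf) (hc.comp_left Complex.zero_im)
  have e1 := integral_re_add_im hi1
  have e2 := integral_re_add_im hi2
  simp only [Complex.coe_algebraMap, RCLike.re_eq_complex_re,
    RCLike.im_eq_complex_im, RCLike.I_to_complex, Complex.re_ofReal_mul,
    Complex.im_ofReal_mul] at e1 e2
  rw [← e1, ← e2, hre, him]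

variable [T2Space G] {A : Type*} [LocallyCStarAlgebra A]

theorem vectorIntegral_smul (c : ℂ) {F : G → A} (hF : Continuous F) (hc : HasCompactSupport F) :
    vectorIntegral μ (fun s => c • F s) = c • vectorIntegral μ F :=
  map_vectorIntegral μ (c • ContinuousLinearMap.id ℂ A) hF hc

theorem vectorIntegral_mul_right {F : G → A} (hF : Continuous F) (hc : HasCompactSupport F)
    (t : G) :
    vectorIntegral μ (fun s => F (s * t)) = (modularInv t : ℂ) • vectorIntegral μ F :=
  IsVectorIntegral.eq μ fun l => by
    rw [map_smul, apply_vectorIntegral μ hF hc, smul_eq_mul]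
    exact (integral_mul_right_modularInv_complex μ (l.continuous.comp hF)
      (hc.comp_left (map_zero l)) t).symm

theorem toSemi_vectorIntegral {F : G → A} (hF : Continuous F) (hc : HasCompactSupport F)
    (p : Seminorm ℂ A) (hp : Continuous p) :
    toSemi p hp (vectorIntegral μ F) = ∫ s, toSemi p hp (F s) ∂μ := by
  refine (SeparatingDual.eq_iff_forall_dual_eq (R := ℂ)).2 fun l => ?_
  rw [← l.integral_comp_comm (integrable_toSemi μ hF hc p hp)]
  exact apply_vectorIntegral μ hF hc (l.comp (toSemi p hp))

end Integrals

/-! ### Operators bounded by an `L¹`-seminorm -/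

section L1Bound

variable {G : Type*} [Group G] [TopologicalSpace G] [IsTopologicalGroup G] [LocallyCompactSpace G]
  [T2Space G] [MeasurableSpace G] [BorelSpace G] {A : Type*} [LocallyCStarAlgebra A]
  {α : ContinuousAction G A} {μ : Measure G} [μ.IsHaarMeasure]

namespace ConvAlgebra

variable (α μ) in
/-- The embedding of `C_c(G, A)` with the seminorm `N_p` into the Banach space `L¹(G, A_p)`, where
`A_p` is the completion of `A` with respect to `p`. -/
noncomputable def toL1 (p : Seminorm ℂ A) (hp : Continuous p) :
    ConvAlgebra α μ →ₗ[ℂ] Lp (UniformSpace.Completion (Semi p)) 1 μ where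
  toFun f := (integrable_toSemi μ f.continuous f.hasCompactSupport p hp).toL1 _
  map_add' f g := by
    rw [← Integrable.toL1_add]
    congr 1
    funext s
    simp [add_apply]
  map_smul' c f := by
    rw [RingHom.id_apply, ← Integrable.toL1_smul']
    congr 1
    funext s
    simp [smul_apply]

theorem coeFn_toL1 (p : Seminorm ℂ A) (hp : Continuous p) (f : ConvAlgebra α μ) :
    toL1 α μ p hp f =ᵐ[μ] fun s => toSemi p hp (f s) :=
  Integrable.coeFn_toL1 (integrable_toSemi μ f.continuous f.hasCompactSupport p hp)

theorem norm_toL1 (p : Seminorm ℂ A) (hp : Continuous p) (f : ConvAlgebra α μ) :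
    ‖toL1 α μ p hp f‖ = ∫ s, p (f s) ∂μ := by
  rw [L1.norm_eq_integral_norm]
  refine integral_congr_ae ?_
  filter_upwards [coeFn_toL1 p hp f] with s hs
  rw [hs, norm_toSemi]

theorem sub_apply (f g : ConvAlgebra α μ) (s : G) : (f - g) s = f s - g s := by
  rw [eq_sub_iff_add_eq, ← add_apply, sub_add_cancel]

variable {W : Type*} [NormedAddCommGroup W] [NormedSpace ℂ W]

theorem continuous_of_norm_le (T : ConvAlgebra α μ →ₗ[ℂ] W) {p : Seminorm ℂ A}
    (hp : Continuous p) {C : ℝ} (hT : ∀ f, ‖T f‖ ≤ C * ∫ s, p (f s) ∂μ) {X : Type*}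
    [TopologicalSpace X] (k : X → ConvAlgebra α μ) (hk : Continuous fun z : X × G => k z.1 z.2)
    (hs : ∀ x₀, ∃ U ∈ 𝓝 x₀, ∃ K, IsCompact K ∧ ∀ x ∈ U, ∀ s ∉ K, k x s = 0) :
    Continuous fun x => T (k x) := by
  rw [continuous_iff_continuousAt]
  intro x₀
  obtain ⟨U, hU, K, hK, h0⟩ := hs x₀
  have hφ : ContinuousOn (fun x => ∫ s, p (k x s - k x₀ s) ∂μ) U := by
    refine continuousOn_integral_of_compact_support hK (Continuous.continuousOn ?_) ?_
    · exact hp.comp (hk.sub ((k x₀).continuous.comp continuous_snd))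
    · intro x s hx hs
      rw [h0 x hx s hs, h0 x₀ (mem_of_mem_nhds hU) s hs, sub_zero, map_zero]
  have hlim := (hφ.continuousAt hU).tendsto
  simp only [sub_self, map_zero, integral_zero] at hlim
  rw [ContinuousAt, tendsto_iff_norm_sub_tendsto_zero]
  have hlim' := hlim.const_mul C
  rw [mul_zero] at hlim'
  refine squeeze_zero (fun _ => norm_nonneg _) (fun x => ?_) hlim'
  rw [← map_sub]
  refine (hT _).trans_eq ?_
  simp only [sub_apply]

/-- Operators bounded by `N_p` commute with integrals of families of elements of `C_c(G, A)`. The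
integral is computed in `L¹(G, A_p)`, where Fubini's theorem identifies it. -/
theorem map_integral_of_norm_le [CompleteSpace W] (T : ConvAlgebra α μ →ₗ[ℂ] W)
    {p : Seminorm ℂ A} (hp : Continuous p) {C : ℝ} (hT : ∀ f, ‖T f‖ ≤ C * ∫ s, p (f s) ∂μ)
    (k : G → ConvAlgebra α μ) (hk : Continuous (fun t s => k t s).uncurry)
    (hs : HasCompactSupport (fun t s => k t s).uncurry) (F : ConvAlgebra α μ)
    (hF : ∀ s, F s = vectorIntegral μ fun t => k t s) : T F = ∫ t, T (k t) ∂μ := by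
  obtain ⟨K, L, hK, hL, h1, h2⟩ := exists_compact_of_hasCompactSupport hs
  have hkt (t : G) (ht : t ∉ K) : k t = 0 := ext (h1 t ht)
  let j := toL1 α μ p hp
  have hj : Continuous fun t => j (k t) :=
    continuous_of_norm_le j hp (C := 1) (fun f => by rw [one_mul]; exact (norm_toL1 p hp f).le) k hk
      fun _ => ⟨Set.univ, univ_mem, L, hL, fun t _ s hs => h2 s hs t⟩
  have hji : Integrable (fun t => j (k t)) μ := hj.integrable_of_hasCompactSupport
    (HasCompactSupport.intro hK fun t ht => by rw [hkt t ht, map_zero])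
  have hjF : ∫ t, j (k t) ∂μ = j F := by
    refine Lp.ext ?_
    refine (L1.integrable_coeFn _).ae_eq_of_forall_setIntegral_eq _ _ (L1.integrable_coeFn _)
      fun S hS _ => ?_
    let Λ : Lp (UniformSpace.Completion (Semi p)) 1 μ →L[ℂ] UniformSpace.Completion (Semi p) :=
      LinearMap.mkContinuous
        { toFun y := ∫ s in S, y s ∂μ
          map_add' y z := by
            rw [← integral_add (L1.integrable_coeFn y).integrableOn
              (L1.integrable_coeFn z).integrableOn]
            exact integral_congr_ae (ae_restrict_of_ae (Lp.coeFn_add y z))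
          map_smul' c y := by
            rw [RingHom.id_apply, ← integral_smul]
            exact integral_congr_ae (ae_restrict_of_ae (Lp.coeFn_smul c y)) } 1 fun y => by
        rw [one_mul, L1.norm_eq_integral_norm]
        exact (norm_integral_le_integral_norm _).trans
          (setIntegral_le_integral (L1.integrable_coeFn y).norm
            (Eventually.of_forall fun s => norm_nonneg _))
    have hΛ (f : ConvAlgebra α μ) : Λ (j f) = ∫ s in S, toSemi p hp (f s) ∂μ :=
      integral_congr_ae (ae_restrict_of_ae (coeFn_toL1 p hp f))
    change Λ (∫ t, j (k t) ∂μ) = Λ (j F)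
    rw [← Λ.integral_comp_comm hji, hΛ]
    simp only [hΛ, hF]
    have hsemi (s : G) : toSemi p hp (vectorIntegral μ fun t => k t s) =
        ∫ t, toSemi p hp (k t s) ∂μ :=
      toSemi_vectorIntegral μ (hk.comp (Continuous.prodMk_left s))
        (HasCompactSupport.intro hK fun t ht => h1 t ht s) p hp
    simp only [hsemi]
    exact integral_integral_swap_of_hasCompactSupport
      (f := fun t s => toSemi p hp (k t s)) ((toSemi p hp).continuous.comp hk)
      (hs.comp_left (map_zero (toSemi p hp)))
  -- `T` factors through the closure `Z` of the range of the embedding.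
  let Z := (LinearMap.range j).topologicalClosure
  let j' : ConvAlgebra α μ →ₗ[ℂ] Z :=
    j.codRestrict Z fun f => Submodule.le_topologicalClosure _ (LinearMap.mem_range_self j f)
  have hdense : DenseRange j' := by
    intro z
    rw [closure_subtype, ← Set.range_comp]
    exact z.2
  have hbound (f : ConvAlgebra α μ) : ‖T f‖ ≤ C * ‖j' f‖ :=
    (hT f).trans_eq (congrArg (C * ·) (norm_toL1 p hp f).symm)
  have : CompleteSpace Z := (Submodule.isClosed_topologicalClosure _).completeSpace_coe
  let T' : Z →L[ℂ] W := T.extendOfNorm j'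
  have hT' (f : ConvAlgebra α μ) : T' (j' f) = T f :=
    LinearMap.extendOfNorm_eq hdense ⟨C, hbound⟩ f
  have hj'i : Integrable (fun t => j' (k t)) μ :=
    (hj.subtype_mk _).integrable_of_hasCompactSupport
      (HasCompactSupport.intro hK fun t ht => by rw [hkt t ht]; exact map_zero j')
  have hj'F : ∫ t, j' (k t) ∂μ = j' F := by
    refine Subtype.ext (Eq.trans ?_ hjF)
    exact (Z.subtypeL.integral_comp_comm hj'i).symm
  rw [← hT' F, ← hj'F, ← T'.integral_comp_comm hj'i]
  simp only [hT']

end ConvAlgebra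
end L1Bound
end LocCStar

namespace LocCStar

section Translations

variable {G : Type*} [Group G] [TopologicalSpace G] [IsTopologicalGroup G] [LocallyCompactSpace G]
  [T2Space G] [MeasurableSpace G] [BorelSpace G] {A : Type*} [LocallyCStarAlgebra A]
  {α : ContinuousAction G A} {μ : Measure G}

/-! ### Multipliers of the convolution algebra -/

namespace ConvAlgebra

/-- The function `g ⊗ a : s ↦ g(s) a`. -/
noncomputable def tensor (α : ContinuousAction G A) (μ : Measure G) (g : G → ℝ) (hg : Continuous g)
    (hc : HasCompactSupport g) (a : A) : ConvAlgebra α μ :=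
  (⟨⟨fun s => (g s : ℂ) • a, (Complex.continuous_ofReal.comp hg).smul continuous_const⟩,
    HasCompactSupport.smul_right (f := fun s => (g s : ℂ)) (hc.comp_left Complex.ofReal_zero)⟩ :
      C_c(G, A))

theorem tensor_apply (g : G → ℝ) (hg : Continuous g) (hc : HasCompactSupport g) (a : A) (s : G) :
    tensor α μ g hg hc a s = (g s : ℂ) • a := rfl

/-- The pointwise product `a · f : s ↦ a f(s)`. -/
noncomputable def leftMul (a : A) : ConvAlgebra α μ →ₗ[ℂ] ConvAlgebra α μ where
  toFun f := (⟨⟨fun s => a * f s, f.continuous.const_mul a⟩, f.hasCompactSupport.mul_left⟩ :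
    C_c(G, A))
  map_add' f g := ext fun s => mul_add a (f s) (g s)
  map_smul' c f := ext fun s => mul_smul_comm c a (f s)

theorem leftMul_apply (a : A) (f : ConvAlgebra α μ) (s : G) : leftMul a f s = a * f s := rfl

/-- The leftTranslate `t · f : s ↦ α_t(f(t⁻¹ s))`. -/
noncomputable def leftTranslate (t : G) : ConvAlgebra α μ →ₗ[ℂ] ConvAlgebra α μ where
  toFun f := (⟨⟨fun s => α t (f (t⁻¹ * s)), α.continuous_apply continuous_const
      (f.continuous.comp (continuous_const_mul t⁻¹))⟩,
    HasCompactSupport.comp_left (g := α t) (f := fun s => f (t⁻¹ * s))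
      (f.hasCompactSupport.comp_homeomorph (Homeomorph.mulLeft t⁻¹)) (map_zero _)⟩ : C_c(G, A))
  map_add' f g := ext fun s => map_add (α t) (f (t⁻¹ * s)) (g (t⁻¹ * s))
  map_smul' c f := ext fun s => map_smul (α t) c (f (t⁻¹ * s))

theorem leftTranslate_apply (t : G) (f : ConvAlgebra α μ) (s : G) :
    leftTranslate t f s = α t (f (t⁻¹ * s)) := rfl

theorem leftMul_add (a b : A) (f : ConvAlgebra α μ) :
    leftMul (a + b) f = leftMul a f + leftMul b f :=
  ext fun s => add_mul a b (f s)

theorem leftMul_smul (c : ℂ) (a : A) (f : ConvAlgebra α μ) :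
    leftMul (c • a) f = c • leftMul a f :=
  ext fun s => smul_mul_assoc c a (f s)

theorem leftMul_mul (a b : A) (f : ConvAlgebra α μ) :
    leftMul (a * b) f = leftMul a (leftMul b f) :=
  ext fun s => mul_assoc a b (f s)

theorem leftTranslate_mul (s t : G) (f : ConvAlgebra α μ) :
    leftTranslate (s * t) f = leftTranslate s (leftTranslate t f) := by
  ext r
  rw [leftTranslate_apply, leftTranslate_apply, leftTranslate_apply, α.mul_apply, mul_inv_rev, mul_assoc]

theorem leftTranslate_one (f : ConvAlgebra α μ) : leftTranslate 1 f = f := by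
  ext r
  rw [leftTranslate_apply, α.one_apply, inv_one, one_mul]

theorem leftTranslate_leftMul (t : G) (a : A) (f : ConvAlgebra α μ) :
    leftTranslate t (leftMul a f) = leftMul (α t a) (leftTranslate t f) :=
  ext fun s => map_mul (α t) a (f (t⁻¹ * s))

variable [μ.IsHaarMeasure]

theorem star_leftMul_mul (a : A) (f h : ConvAlgebra α μ) :
    star (leftMul a f) * h = star f * leftMul (star a) h := by
  ext s
  rw [mul_apply, mul_apply]
  congr 1
  funext t
  rw [kernel, kernel, star_apply, star_apply, leftMul_apply, leftMul_apply, star_mul,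
    map_mul (α t), map_mul (α t), smul_mul_assoc, smul_mul_assoc, mul_assoc]

theorem star_translate_mul_translate (t : G) (f h : ConvAlgebra α μ) :
    star (leftTranslate t f) * leftTranslate t h = star f * h := by
  ext s
  rw [mul_apply, mul_apply]
  have hinv : modularInv t⁻¹ * modularInv t = 1 := by
    rw [← modularInv_mul, inv_mul_cancel, modularInv_one]
  have hker (r : G) : kernel (star (leftTranslate t f)) (leftTranslate t h) s r =
      (modularInv t⁻¹ : ℂ) • kernel (star f) h s (r * t) := by
    have e1 : t⁻¹ * r⁻¹ = (r * t)⁻¹ := by group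
    have e2 : t⁻¹ * (r⁻¹ * s) = (r * t)⁻¹ * s := by group
    have e3 : modularInv r = modularInv t⁻¹ * modularInv (r * t) := by
      rw [modularInv_mul, mul_left_comm, hinv, mul_one]
    rw [kernel, kernel, star_apply, star_apply, leftTranslate_apply, leftTranslate_apply, e1, e2,
      ← map_star (α t), ← α.mul_apply, ← α.mul_apply, e3, Complex.ofReal_mul, mul_smul,
      smul_mul_assoc]
  rw [funext hker]
  have hc := continuous_kernel_right (star f) h s
  have hs := hasCompactSupport_kernel_right (star f) h s
  rw [vectorIntegral_smul μ _ (F := fun r => kernel (star f) h s (r * t)) (hc.comp (continuous_mul_const t))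
      (hs.comp_homeomorph (Homeomorph.mulRight t)),
    vectorIntegral_mul_right μ hc hs, smul_smul, ← Complex.ofReal_mul, hinv, Complex.ofReal_one,
    one_smul]

variable {W : Type*} [NormedAddCommGroup W] [NormedSpace ℂ W]

/-- Convolution by `f` is the integral of the operators `h ↦ f(t) · (t · h)`. -/
theorem map_mul_eq_integral [CompleteSpace W] (T : ConvAlgebra α μ →ₗ[ℂ] W)
    {p : Seminorm ℂ A} (hp : Continuous p) {C : ℝ} (hT : ∀ f, ‖T f‖ ≤ C * ∫ s, p (f s) ∂μ)
    (f h : ConvAlgebra α μ) : T (f * h) = ∫ t, T (leftMul (f t) (leftTranslate t h)) ∂μ := by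
  refine map_integral_of_norm_le T hp hT (fun t => leftMul (f t) (leftTranslate t h))
    ((continuous_kernel f h).comp continuous_swap)
    ((hasCompactSupport_kernel f h).comp_homeomorph (Homeomorph.prodComm G G)) (f * h)
    fun s => rfl

open scoped Pointwise in
theorem continuous_map_translate (T : ConvAlgebra α μ →ₗ[ℂ] W)
    {p : Seminorm ℂ A} (hp : Continuous p) {C : ℝ} (hT : ∀ f, ‖T f‖ ≤ C * ∫ s, p (f s) ∂μ)
    (h : ConvAlgebra α μ) : Continuous fun t => T (leftTranslate t h) := by
  refine continuous_of_norm_le T hp hT (fun t => leftTranslate t h)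
    (α.continuous_apply continuous_fst
      (h.continuous.comp (continuous_fst.inv.mul continuous_snd))) fun t₀ => ?_
  obtain ⟨U, hU, hUn⟩ := exists_compact_mem_nhds t₀
  refine ⟨U, hUn, U * tsupport h, hU.mul h.hasCompactSupport, fun t ht s hs => ?_⟩
  rw [leftTranslate_apply, image_eq_zero_of_notMem_tsupport fun hm => hs ⟨t, ht, _, hm, by simp⟩,
    map_zero]

theorem continuous_map_leftMul_translate (T : ConvAlgebra α μ →ₗ[ℂ] W)
    {p : Seminorm ℂ A} (hp : Continuous p) {C : ℝ} (hT : ∀ f, ‖T f‖ ≤ C * ∫ s, p (f s) ∂μ)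
    (a : A) (h : ConvAlgebra α μ) : Continuous fun t => T (leftMul a (leftTranslate t h)) :=
  continuous_map_translate (T ∘ₗ leftMul a) (p := p.comp (mulLeftCLM a).toLinearMap)
    (hp.comp (continuous_const_mul a)) (fun f => hT (leftMul a f)) h

end ConvAlgebra

end Translations

/-! ### The integrated form of a covariant representation -/

namespace NondegenerateCovariantRep

open ConvAlgebra

variable {G : Type*} [Group G] [TopologicalSpace G] [IsTopologicalGroup G] [LocallyCompactSpace G]
  [T2Space G] [MeasurableSpace G] [BorelSpace G] {A : Type*} [LocallyCStarAlgebra A]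
  {α : ContinuousAction G A} {μ : Measure G} [μ.IsHaarMeasure]
  {H : Type*} [NormedAddCommGroup H] [InnerProductSpace ℂ H] [CompleteSpace H]
  (ρ : NondegenerateCovariantRep H α)

/-- The unitary operator `u_t`. -/
noncomputable abbrev op (t : G) : H →L[ℂ] H := (ρ.u t : H →L[ℂ] H)

theorem op_mul (s t : G) (ξ : H) : ρ.op (s * t) ξ = ρ.op s (ρ.op t ξ) := by
  simp [op]

theorem star_op (t : G) : star (ρ.op t) = ρ.op t⁻¹ := by
  rw [op, op, map_inv, ← Unitary.star_eq_inv]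
  rfl

theorem op_inv_op (t : G) (ξ : H) : ρ.op t⁻¹ (ρ.op t ξ) = ξ := by
  rw [← op_mul]
  simp [op]

theorem norm_op (t : G) (ξ : H) : ‖ρ.op t ξ‖ = ‖ξ‖ :=
  ContinuousLinearMap.norm_map_of_mem_unitary (ρ.u t).2 ξ

theorem rep_action (t : G) (a : A) (ξ : H) :
    ρ.rep.toHom (α t a) (ρ.op t ξ) = ρ.op t (ρ.rep.toHom a ξ) := by
  rw [ρ.covariant, mul_apply_eq_comp, mul_apply_eq_comp]
  change ρ.op t (ρ.rep.toHom a (star (ρ.op t) (ρ.op t ξ))) = _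
  rw [star_op, op_inv_op]

/-- The seminorm `a ↦ ‖φ(a)‖`. -/
noncomputable def seminorm : Seminorm ℂ A := (normSeminorm ℂ (H →L[ℂ] H)).comp (ρ.rep.toHom : A →ₗ[ℂ] (H →L[ℂ] H))

theorem seminorm_apply (a : A) : ρ.seminorm a = ‖ρ.rep.toHom a‖ := rfl

/-- Covariance makes `a ↦ ‖φ(a)‖` a `G`-invariant `C*`-seminorm. -/
theorem isInvariantCStarSeminorm : α.IsInvariantCStarSeminorm ρ.seminorm where
  isCStarSeminorm :=
    { mul_le a b := by
        simp only [seminorm_apply, map_mul]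
        exact norm_mul_le _ _
      star_mul_self a := by
        simp only [seminorm_apply, map_mul, map_star, CStarRing.norm_star_mul_self, sq] }
  continuous := ρ.rep.continuous.norm
  invariant t a := by
    rw [seminorm_apply, seminorm_apply, ρ.covariant, ← Unitary.coe_star,
      CStarRing.norm_mul_coe_unitary, CStarRing.norm_coe_unitary_mul]

theorem continuous_integrand {f : G → A} (hf : Continuous f) (ξ : H) :
    Continuous fun t => ρ.rep.toHom (f t) (ρ.op t ξ) :=
  (ρ.rep.continuous.comp hf).clm_apply (ρ.continuous_u ξ)

theorem integrable_integrand (f : ConvAlgebra α μ) (ξ : H) :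
    Integrable (fun t => ρ.rep.toHom (f t) (ρ.op t ξ)) μ :=
  (ρ.continuous_integrand f.continuous ξ).integrable_of_hasCompactSupport <|
    HasCompactSupport.intro f.hasCompactSupport fun t ht => by
      rw [image_eq_zero_of_notMem_tsupport ht, map_zero, _root_.zero_apply]

theorem norm_integral_le (f : ConvAlgebra α μ) (ξ : H) :
    ‖∫ t, ρ.rep.toHom (f t) (ρ.op t ξ) ∂μ‖ ≤ (∫ t, ρ.seminorm (f t) ∂μ) * ‖ξ‖ := by
  rw [← MeasureTheory.integral_mul_const]
  refine norm_integral_le_of_norm_le ?_ (Eventually.of_forall fun t => ?_)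
  · refine Integrable.mul_const ?_ _
    exact (ρ.isInvariantCStarSeminorm.continuous.comp
      f.continuous).integrable_of_hasCompactSupport
      (f.hasCompactSupport.comp_left (map_zero ρ.seminorm))
  · rw [← ρ.norm_op t ξ]
    exact (ρ.rep.toHom (f t)).le_opNorm _

/-- The operator `∫ φ(f(t)) u_t dt`. -/
noncomputable def integrated (μ : Measure G) [μ.IsHaarMeasure] (f : ConvAlgebra α μ) : H →L[ℂ] H :=
  LinearMap.mkContinuous
    { toFun ξ := ∫ t, ρ.rep.toHom (f t) (ρ.op t ξ) ∂μ
      map_add' ξ η := by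
        simp only [map_add]
        exact integral_add (ρ.integrable_integrand f ξ) (ρ.integrable_integrand f η)
      map_smul' c ξ := by
        simp only [map_smul]
        exact integral_smul c _ }
    (∫ t, ρ.seminorm (f t) ∂μ) (ρ.norm_integral_le f)

theorem integrated_apply (f : ConvAlgebra α μ) (ξ : H) :
    ρ.integrated μ f ξ = ∫ t, ρ.rep.toHom (f t) (ρ.op t ξ) ∂μ := rfl

theorem norm_integrated_le (f : ConvAlgebra α μ) :
    ‖ρ.integrated μ f‖ ≤ ∫ t, ρ.seminorm (f t) ∂μ :=
  LinearMap.mkContinuous_norm_le _ (integral_nonneg fun _ => apply_nonneg _ _) _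

theorem inner_integrated (f : ConvAlgebra α μ) (η ξ : H) :
    ⟪η, ρ.integrated μ f ξ⟫_ℂ = ∫ t, ⟪η, ρ.rep.toHom (f t) (ρ.op t ξ)⟫_ℂ ∂μ :=
  (integral_inner (ρ.integrable_integrand f ξ) η).symm

/-- The continuous linear functional `a ↦ ⟨η, φ(a) ξ⟩`. -/
noncomputable def coefficient (η ξ : H) : A →L[ℂ] ℂ where
  toFun a := ⟪η, ρ.rep.toHom a ξ⟫_ℂ
  map_add' a b := by rw [map_add, _root_.add_apply, inner_add_right]
  map_smul' c a := by
    rw [map_smul, _root_.smul_apply, inner_smul_right, RingHom.id_apply, smul_eq_mul]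
  cont := by
    have := ρ.rep.continuous
    fun_prop

theorem integrated_mul (f h : ConvAlgebra α μ) :
    ρ.integrated μ (f * h) = ρ.integrated μ f * ρ.integrated μ h := by
  ext ξ
  refine ext_inner_left ℂ fun η => ?_
  let k : G → G → ℂ := fun s t => ⟪η, ρ.rep.toHom (kernel f h s t) (ρ.op s ξ)⟫_ℂ
  have hk : Continuous k.uncurry := by
    have h1 : Continuous fun z : G × G => ρ.rep.toHom (kernel f h z.1 z.2) :=
      ρ.rep.continuous.comp (continuous_kernel f h)
    exact continuous_const.inner (h1.clm_apply ((ρ.continuous_u ξ).comp continuous_fst))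
  have hs : HasCompactSupport k.uncurry := by
    refine (hasCompactSupport_kernel f h).mono fun z hz h0 => hz ?_
    change ⟪η, ρ.rep.toHom (kernel f h z.1 z.2) (ρ.op z.1 ξ)⟫_ℂ = 0
    rw [show kernel f h z.1 z.2 = 0 from h0, map_zero, _root_.zero_apply,
      inner_zero_right]
  calc ⟪η, ρ.integrated μ (f * h) ξ⟫_ℂ = ∫ s, ∫ t, k s t ∂μ ∂μ := by
        rw [inner_integrated]
        refine integral_congr_ae (Eventually.of_forall fun s => ?_)
        exact apply_vectorIntegral μ (continuous_kernel_right f h s)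
          (hasCompactSupport_kernel_right f h s) (ρ.coefficient η (ρ.op s ξ))
    _ = ∫ t, ∫ s, k s t ∂μ ∂μ := integral_integral_swap_of_hasCompactSupport hk hs
    _ = ∫ t, ⟪η, ρ.rep.toHom (f t) (ρ.op t (ρ.integrated μ h ξ))⟫_ℂ ∂μ := by
        refine integral_congr_ae (Eventually.of_forall fun t => ?_)
        simp only
        rw [← integral_mul_left_eq_self (fun s => k s t) t, integrated_apply,
          ← (ρ.op t).integral_comp_comm (ρ.integrable_integrand h ξ),
          ← (ρ.rep.toHom (f t)).integral_comp_comm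
            ((ρ.op t).integrable_comp (ρ.integrable_integrand h ξ)),
          ← integral_inner ((ρ.rep.toHom (f t)).integrable_comp
            ((ρ.op t).integrable_comp (ρ.integrable_integrand h ξ)))]
        refine integral_congr_ae (Eventually.of_forall fun s => ?_)
        simp only [k, kernel]
        rw [inv_mul_cancel_left, map_mul, mul_apply_eq_comp, op_mul, rep_action]
    _ = _ := (ρ.inner_integrated f η _).symm

theorem integrated_star (f : ConvAlgebra α μ) :
    ρ.integrated μ (star f) = star (ρ.integrated μ f) := by
  rw [ContinuousLinearMap.star_eq_adjoint, ContinuousLinearMap.eq_adjoint_iff]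
  intro η ξ
  rw [← inner_conj_symm, inner_integrated]
  have hint (t : G) : ⟪ξ, ρ.rep.toHom ((star f) t) (ρ.op t η)⟫_ℂ =
      (modularInv t : ℂ) * ⟪ρ.rep.toHom (f t⁻¹) (ρ.op t⁻¹ ξ), η⟫_ℂ := by
    rw [star_apply, map_smul, _root_.smul_apply, inner_smul_right, rep_action,
      ← inv_inv t, ← star_op, inv_inv, ContinuousLinearMap.star_eq_adjoint,
      ContinuousLinearMap.adjoint_inner_right, map_star, ContinuousLinearMap.star_eq_adjoint,
      ContinuousLinearMap.adjoint_inner_right]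
  simp only [hint]
  rw [integral_inv_modularInv_complex μ
    (f := fun t => ⟪ρ.rep.toHom (f t) (ρ.op t ξ), η⟫_ℂ)
    ((ρ.continuous_integrand f.continuous ξ).inner continuous_const)
    (HasCompactSupport.intro f.hasCompactSupport fun t ht => by
      rw [image_eq_zero_of_notMem_tsupport ht, map_zero, _root_.zero_apply,
        inner_zero_left]), ← integral_conj]
  simp only [inner_conj_symm]
  rw [inner_integrated]

variable (μ) in
/-- The `*`-representation `f ↦ ∫ φ(f(t)) u_t dt` of `C_c(G, A)`. -/
noncomputable def integratedHom : ConvAlgebra α μ →⋆ₙₐ[ℂ] (H →L[ℂ] H) where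
  toFun := ρ.integrated μ
  map_zero' := by
    ext ξ
    rw [integrated_apply]
    simp [ConvAlgebra.zero_apply]
  map_add' f g := by
    ext ξ
    rw [_root_.add_apply, integrated_apply, integrated_apply, integrated_apply,
      ← integral_add (ρ.integrable_integrand f ξ) (ρ.integrable_integrand g ξ)]
    simp only [ConvAlgebra.add_apply, map_add, _root_.add_apply]
  map_smul' c f := by
    ext ξ
    rw [MonoidHom.id_apply, _root_.smul_apply, integrated_apply, integrated_apply,
      ← integral_smul]
    simp only [ConvAlgebra.smul_apply, map_smul, _root_.smul_apply]
  map_mul' := ρ.integrated_mul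
  map_star' := ρ.integrated_star

theorem integratedHom_apply (f : ConvAlgebra α μ) (ξ : H) :
    ρ.integratedHom μ f ξ = ∫ t, ρ.rep.toHom (f t) (ρ.op t ξ) ∂μ := rfl

theorem integratedHom_tensor (g : G → ℝ) (hg : Continuous g) (hc : HasCompactSupport g) (a : A)
    (ξ : H) : ρ.integratedHom μ (tensor α μ g hg hc a) ξ =
      ∫ t, (g t : ℂ) • ρ.rep.toHom a (ρ.op t ξ) ∂μ := by
  rw [integratedHom_apply]
  simp only [tensor_apply, map_smul, _root_.smul_apply]

end NondegenerateCovariantRep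

end LocCStar

namespace LocCStar

open ConvAlgebra
open scoped TensorProduct

variable {G : Type*} [Group G] [TopologicalSpace G] [IsTopologicalGroup G] [LocallyCompactSpace G]
  [T2Space G] [MeasurableSpace G] [BorelSpace G] {A : Type*} [LocallyCStarAlgebra A]
  {α : ContinuousAction G A} {μ : Measure G} [μ.IsHaarMeasure]
  {H : Type*} [NormedAddCommGroup H] [InnerProductSpace ℂ H] [CompleteSpace H]

/-! ### Disintegration of representations of the convolution algebra -/

section Disintegration

variable (T : ConvAlgebra α μ →⋆ₙₐ[ℂ] (H →L[ℂ] H))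

/-- The linear map `f ⊗ ξ ↦ T(f) ξ`. Defining operators on `C_c(G, A) ⊗ H` and passing to the image
avoids the question whether they are well defined on the span of the vectors `T(f) ξ`. -/
noncomputable def evalTensor : ConvAlgebra α μ ⊗[ℂ] H →ₗ[ℂ] H :=
  TensorProduct.lift
    { toFun f := (T f).toLinearMap
      map_add' f g := by rw [map_add]; rfl
      map_smul' c f := by rw [map_smul]; rfl }

theorem evalTensor_tmul (f : ConvAlgebra α μ) (ξ : H) : evalTensor T (f ⊗ₜ ξ) = T f ξ := rfl

theorem denseRange_evalTensor (hT : IsNondegenerate T) : DenseRange (evalTensor T) := by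
  have h : Submodule.span ℂ {ζ : H | ∃ a ξ, T a ξ = ζ} ≤ LinearMap.range (evalTensor T) := by
    rw [Submodule.span_le]
    rintro _ ⟨f, ξ, rfl⟩
    exact ⟨f ⊗ₜ ξ, rfl⟩
  intro v
  have hv : v ∈ (Submodule.span ℂ {ζ : H | ∃ a ξ, T a ξ = ζ}).topologicalClosure := by
    rw [show _ = _ from hT]
    trivial
  exact Submodule.topologicalClosure_mono h hv

theorem inner_evalTensor_rTensor {B D : ConvAlgebra α μ →ₗ[ℂ] ConvAlgebra α μ}
    (h : ∀ f g, star (B f) * g = star f * D g) (x y : ConvAlgebra α μ ⊗[ℂ] H) :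
    ⟪evalTensor T (B.rTensor H x), evalTensor T y⟫_ℂ =
      ⟪evalTensor T x, evalTensor T (D.rTensor H y)⟫_ℂ := by
  have key (f g : ConvAlgebra α μ) (ξ η : H) : ⟪T f ξ, T g η⟫_ℂ = ⟪ξ, T (star f * g) η⟫_ℂ := by
    rw [map_mul, map_star, mul_apply_eq_comp, ContinuousLinearMap.star_eq_adjoint,
      ContinuousLinearMap.adjoint_inner_right]
  induction x with
  | zero => simp
  | add x₁ x₂ h₁ h₂ => rw [map_add, map_add, inner_add_left, h₁, h₂, map_add, inner_add_left]
  | tmul f ξ =>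
    induction y with
    | zero => simp
    | add y₁ y₂ h₁ h₂ =>
      rw [map_add, map_add, map_add, inner_add_right, h₁, h₂, inner_add_right]
    | tmul g η =>
      rw [LinearMap.rTensor_tmul, LinearMap.rTensor_tmul, evalTensor_tmul, evalTensor_tmul,
        evalTensor_tmul, evalTensor_tmul, key, key, h]

variable {p : Seminorm ℂ A} (hp : Continuous p) {C : ℝ} (hT : ∀ f, ‖T f‖ ≤ C * ∫ s, p (f s) ∂μ)
include hp hT

theorem map_mul_apply_eq_integral (f h : ConvAlgebra α μ) (ξ : H) :
    Integrable (fun t => T (leftMul (f t) (leftTranslate t h)) ξ) μ ∧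
      T (f * h) ξ = ∫ t, T (leftMul (f t) (leftTranslate t h)) ξ ∂μ := by
  have hc : Continuous fun t => T (leftMul (f t) (leftTranslate t h)) := by
    obtain ⟨K, L, hK, hL, h1, h2⟩ :=
      exists_compact_of_hasCompactSupport (hasCompactSupport_kernel f h)
    exact continuous_of_norm_le (T : ConvAlgebra α μ →ₗ[ℂ] (H →L[ℂ] H)) hp hT
      (fun t => leftMul (f t) (leftTranslate t h)) ((continuous_kernel f h).comp continuous_swap)
      fun _ => ⟨Set.univ, univ_mem, K, hK, fun t _ s hs => h1 s hs t⟩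
  have hi : Integrable (fun t => T (leftMul (f t) (leftTranslate t h))) μ :=
    hc.integrable_of_hasCompactSupport <| HasCompactSupport.intro f.hasCompactSupport fun t ht => by
      rw [image_eq_zero_of_notMem_tsupport ht,
        show leftMul 0 (leftTranslate t h) = 0 from ConvAlgebra.ext fun s => zero_mul _, map_zero]
  refine ⟨(ContinuousLinearMap.apply ℂ H ξ).integrable_comp hi, ?_⟩
  rw [← ContinuousLinearMap.integral_apply hi]
  exact congrArg (· ξ)
    (map_mul_eq_integral (T : ConvAlgebra α μ →ₗ[ℂ] (H →L[ℂ] H)) hp hT f h)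

theorem continuous_evalTensor_translate (x : ConvAlgebra α μ ⊗[ℂ] H) :
    Continuous fun t => evalTensor T ((leftTranslate t).rTensor H x) := by
  induction x with
  | zero => simpa using continuous_const
  | add x y hx hy =>
    simp only [map_add]
    exact hx.add hy
  | tmul h ξ =>
    exact (continuous_map_translate (T : ConvAlgebra α μ →ₗ[ℂ] (H →L[ℂ] H)) hp hT h).clm_apply
      continuous_const

theorem continuous_evalTensor_leftMul_translate (a : A) (x : ConvAlgebra α μ ⊗[ℂ] H) :
    Continuous fun t => evalTensor T ((leftMul a).rTensor H ((leftTranslate t).rTensor H x)) := by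
  induction x with
  | zero => simpa using continuous_const
  | add x y hx hy =>
    simp only [map_add]
    exact hx.add hy
  | tmul h ξ =>
    exact (continuous_map_leftMul_translate (T : ConvAlgebra α μ →ₗ[ℂ] (H →L[ℂ] H)) hp hT a
      h).clm_apply continuous_const

theorem map_tensor_evalTensor (g : G → ℝ) (hg : Continuous g) (hc : HasCompactSupport g) (a : A)
    (x : ConvAlgebra α μ ⊗[ℂ] H) : T (tensor α μ g hg hc a) (evalTensor T x) =
      ∫ t, (g t : ℂ) • evalTensor T ((leftMul a).rTensor H ((leftTranslate t).rTensor H x)) ∂μ := by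
  have hi (x : ConvAlgebra α μ ⊗[ℂ] H) : Integrable (fun t => (g t : ℂ) •
      evalTensor T ((leftMul a).rTensor H ((leftTranslate t).rTensor H x))) μ :=
    ((Complex.continuous_ofReal.comp hg).smul
      (continuous_evalTensor_leftMul_translate T hp hT a x)).integrable_of_hasCompactSupport
      (HasCompactSupport.smul_right (f := fun t => (g t : ℂ)) (hc.comp_left Complex.ofReal_zero))
  induction x with
  | zero => simp
  | add x y hx hy =>
    simp only [map_add, smul_add, hx, hy]
    exact (integral_add (hi x) (hi y)).symm
  | tmul h ξ =>
    rw [evalTensor_tmul, ← mul_apply_eq_comp, ← map_mul,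
      (map_mul_apply_eq_integral T hp hT _ h ξ).2]
    refine integral_congr_ae (Eventually.of_forall fun t => ?_)
    simp only
    rw [tensor_apply, leftMul_smul, map_smul]
    rfl

/-- Left multiplication by `a` is bounded on the vectors `T(f) ξ`: the averages of the translates of
`a · x` are the vectors `T(g ⊗ a) x`, and `‖T(g ⊗ a)‖ ≤ C p(a) ∫ g`. -/
theorem norm_evalTensor_leftMul_le (a : A) (x : ConvAlgebra α μ ⊗[ℂ] H) :
    ‖evalTensor T ((leftMul a).rTensor H x)‖ ≤ C * p a * ‖evalTensor T x‖ := by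
  have h1 : (leftTranslate (1 : G)).rTensor H x = x := by
    rw [show leftTranslate (1 : G) = (LinearMap.id : ConvAlgebra α μ →ₗ[ℂ] _) from
      LinearMap.ext leftTranslate_one, LinearMap.rTensor_id, LinearMap.id_apply]
  have h2 := norm_le_of_norm_integral_smul_le μ
    (continuous_evalTensor_leftMul_translate T hp hT a x) (M := C * p a * ‖evalTensor T x‖)
    (fun g hg hc hnn => ?_) 1
  · rwa [h1] at h2
  · rw [← map_tensor_evalTensor T hp hT g hg hc]
    refine (ContinuousLinearMap.le_opNorm _ _).trans ?_
    refine (mul_le_mul_of_nonneg_right (hT _) (norm_nonneg _)).trans_eq ?_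
    have : (∫ s, p (tensor α μ g hg hc a s) ∂μ) = (∫ s, g s ∂μ) * p a := by
      rw [← MeasureTheory.integral_mul_const]
      refine integral_congr_ae (Eventually.of_forall fun s => ?_)
      simp only
      rw [tensor_apply, map_smul_eq_mul, Complex.norm_real, Real.norm_of_nonneg (hnn s)]
    rw [this]
    ring

theorem exists_rep_of_convAlgebra (hnd : IsNondegenerate T) :
    ∃ φ : A →⋆ₙₐ[ℂ] (H →L[ℂ] H), Continuous φ ∧
      ∀ a x, φ a (evalTensor T x) = evalTensor T ((leftMul a).rTensor H x) := by
  obtain ⟨φ, hφ, hb⟩ := exists_starHom_of_denseRange (denseRange_evalTensor T hnd)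
    (fun a : A => (leftMul a).rTensor H) (fun a => C * p a)
    (fun a b x => by
      rw [← map_add, ← LinearMap.add_apply, ← LinearMap.rTensor_add,
        show leftMul (a + b) = leftMul a + leftMul b from LinearMap.ext (leftMul_add a b)])
    (fun c a x => by
      rw [← map_smul, ← LinearMap.smul_apply, ← LinearMap.rTensor_smul,
        show leftMul (c • a) = c • leftMul a from LinearMap.ext (leftMul_smul c a)])
    (fun a b x => by
      rw [← LinearMap.rTensor_comp_apply,
        show leftMul (a * b) = leftMul a ∘ₗ leftMul b from LinearMap.ext (leftMul_mul a b)])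
    (fun a x y => inner_evalTensor_rTensor T (star_leftMul_mul a) x y)
    (fun a x => norm_evalTensor_leftMul_le T hp hT a x)
  refine ⟨φ, ?_, hφ⟩
  refine continuous_of_continuousAt_zero φ ?_
  have hlim := (hp.tendsto 0).const_mul |C|
  rw [map_zero, mul_zero] at hlim
  rw [ContinuousAt, map_zero]
  refine squeeze_zero_norm (fun a => ?_) hlim
  refine ContinuousLinearMap.opNorm_le_bound _ (by positivity) fun v => (hb a v).trans ?_
  gcongr
  exact le_abs_self C

theorem exists_unitary_of_convAlgebra (hnd : IsNondegenerate T) :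
    ∃ u : G →* unitary (H →L[ℂ] H), (∀ ξ, Continuous fun t => (u t : H →L[ℂ] H) ξ) ∧
      ∀ t x, (u t : H →L[ℂ] H) (evalTensor T x) = evalTensor T ((leftTranslate t).rTensor H x) := by
  have hS := denseRange_evalTensor T hnd
  have hmul (s t : G) (x : ConvAlgebra α μ ⊗[ℂ] H) :
      (leftTranslate (s * t)).rTensor H x = (leftTranslate s).rTensor H ((leftTranslate t).rTensor H x) := by
    rw [← LinearMap.rTensor_comp_apply, show leftTranslate (s * t) =
      leftTranslate s ∘ₗ (leftTranslate t : ConvAlgebra α μ →ₗ[ℂ] _) from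
      LinearMap.ext (leftTranslate_mul s t)]
  have hone (x : ConvAlgebra α μ ⊗[ℂ] H) : (leftTranslate (1 : G)).rTensor H x = x := by
    rw [show leftTranslate (1 : G) = (LinearMap.id : ConvAlgebra α μ →ₗ[ℂ] _) from
      LinearMap.ext leftTranslate_one, LinearMap.rTensor_id, LinearMap.id_apply]
  have hinner (t : G) (x y : ConvAlgebra α μ ⊗[ℂ] H) :
      ⟪evalTensor T ((leftTranslate t).rTensor H x), evalTensor T y⟫_ℂ =
        ⟪evalTensor T x, evalTensor T ((leftTranslate t⁻¹).rTensor H y)⟫_ℂ :=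
    inner_evalTensor_rTensor T (fun f g => by
      rw [← star_translate_mul_translate t f, ← leftTranslate_mul, mul_inv_cancel, leftTranslate_one]) x y
  have hnorm (t : G) (x : ConvAlgebra α μ ⊗[ℂ] H) :
      ‖evalTensor T ((leftTranslate t).rTensor H x)‖ = ‖evalTensor T x‖ := by
    rw [@norm_eq_sqrt_re_inner ℂ, hinner, ← hmul, inv_mul_cancel, hone,
      ← @norm_eq_sqrt_re_inner ℂ]
  let U (t : G) : H →L[ℂ] H :=
    (evalTensor T ∘ₗ (leftTranslate t).rTensor H).extendOfNorm (evalTensor T)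
  have hbound (t : G) (x : ConvAlgebra α μ ⊗[ℂ] H) :
      ‖(evalTensor T ∘ₗ (leftTranslate t).rTensor H) x‖ ≤ 1 * ‖evalTensor T x‖ := by
    rw [one_mul]
    exact (hnorm t x).le
  have hU (t : G) (x : ConvAlgebra α μ ⊗[ℂ] H) :
      U t (evalTensor T x) = evalTensor T ((leftTranslate t).rTensor H x) :=
    LinearMap.extendOfNorm_eq hS ⟨1, hbound t⟩ x
  have hUn (t : G) (v : H) : ‖U t v‖ ≤ ‖v‖ := by
    simpa using LinearMap.norm_extendOfNorm_apply_le hS 1 (hbound t) v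
  have ext {V W : H →L[ℂ] H} (h : ∀ x, V (evalTensor T x) = W (evalTensor T x)) : V = W :=
    DFunLike.coe_injective (hS.equalizer V.continuous W.continuous (funext h))
  have hUmul (s t : G) : U (s * t) = U s * U t :=
    ext fun x => by rw [mul_apply_eq_comp, hU, hU, hU, hmul]
  have hUone : U 1 = 1 := ext fun x => by rw [hU, hone, one_apply_eq_self]
  have hUstar (t : G) : star (U t) = U t⁻¹ := by
    rw [ContinuousLinearMap.star_eq_adjoint, eq_comm, ContinuousLinearMap.eq_adjoint_iff]
    intro v w
    refine hS.induction_on₂ (p := fun v w => ⟪U t⁻¹ v, w⟫_ℂ = ⟪v, U t w⟫_ℂ)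
      (isClosed_eq (by fun_prop) (by fun_prop)) (fun x y => ?_) v w
    rw [hU, hU, hinner, inv_inv]
  have hUunit (t : G) : U t ∈ unitary (H →L[ℂ] H) := by
    rw [Unitary.mem_iff, hUstar, ← hUmul, ← hUmul, inv_mul_cancel, mul_inv_cancel, hUone]
    exact ⟨rfl, rfl⟩
  refine ⟨{ toFun t := ⟨U t, hUunit t⟩
            map_one' := Subtype.ext hUone
            map_mul' s t := Subtype.ext (hUmul s t) }, fun ξ => ?_, hU⟩
  -- Strong continuity holds on a dense set of vectors, and the operators are contractions.
  refine continuous_of_uniform_approx_of_continuous fun V hV => ?_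
  obtain ⟨ε, hε, hV⟩ := Metric.mem_uniformity_dist.1 hV
  obtain ⟨x, hx⟩ := hS.exists_dist_lt ξ hε
  refine ⟨_, continuous_evalTensor_translate T hp hT x, fun t => hV ?_⟩
  change dist (U t ξ) _ < ε
  rw [← hU, dist_eq_norm, ← map_sub]
  exact (hUn t _).trans_lt (by rwa [← dist_eq_norm])

/-- Every non-degenerate representation of `C_c(G, A)` bounded by a multiple of `N_p` is the
integrated form of a covariant representation. -/
theorem exists_integratedHom_eq (hnd : IsNondegenerate T) :
    ∃ ρ : NondegenerateCovariantRep H α, ρ.integratedHom μ = T := by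
  have hS := denseRange_evalTensor T hnd
  obtain ⟨φ, hφc, hφ⟩ := exists_rep_of_convAlgebra T hp hT hnd
  obtain ⟨u, huc, hu⟩ := exists_unitary_of_convAlgebra T hp hT hnd
  have hint (f h : ConvAlgebra α μ) (ξ : H) :
      Integrable (fun t => φ (f t) ((u t : H →L[ℂ] H) (T h ξ))) μ ∧
        T f (T h ξ) = ∫ t, φ (f t) ((u t : H →L[ℂ] H) (T h ξ)) ∂μ := by
    have e (t : G) : φ (f t) ((u t : H →L[ℂ] H) (T h ξ)) =
        T (leftMul (f t) (leftTranslate t h)) ξ := by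
      rw [← evalTensor_tmul, hu, hφ]
      rfl
    simp only [e]
    rw [← mul_apply_eq_comp, ← map_mul]
    exact map_mul_apply_eq_integral T hp hT f h ξ
  have hφnd : IsNondegenerate φ := by
    refine (isNondegenerate_iff φ).2 fun η hη => (isNondegenerate_iff T).1 hnd η fun f => ?_
    have hzero (h : ConvAlgebra α μ) (ξ : H) : ⟪η, T (star f) (T h ξ)⟫_ℂ = 0 := by
      rw [(hint _ h ξ).2, ← integral_inner (hint _ h ξ).1]
      refine integral_eq_zero_of_ae (Eventually.of_forall fun t => ?_)
      simp only [Pi.zero_apply]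
      rw [← ContinuousLinearMap.adjoint_inner_left, ← ContinuousLinearMap.star_eq_adjoint,
        ← map_star, hη, inner_zero_left]
    refine (isNondegenerate_iff T).1 hnd _ fun h => ext_inner_right ℂ fun ξ => ?_
    rw [inner_zero_left, ← hzero (star h) ξ, map_star, map_star,
      ContinuousLinearMap.star_eq_adjoint, ContinuousLinearMap.star_eq_adjoint,
      ContinuousLinearMap.adjoint_inner_right, ContinuousLinearMap.adjoint_inner_right]
  let ρ : NondegenerateCovariantRep H α :=
    { rep := ⟨φ, hφc, hφnd⟩
      u := u
      continuous_u := huc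
      covariant t a := by
        have hstar : star (u t : H →L[ℂ] H) = (u t⁻¹ : H →L[ℂ] H) := by
          rw [map_inv, ← Unitary.star_eq_inv]
          rfl
        have hconj : (leftTranslate t ∘ₗ leftMul a) ∘ₗ leftTranslate t⁻¹ =
            (leftMul (α t a) : ConvAlgebra α μ →ₗ[ℂ] _) := LinearMap.ext fun f => by
          rw [LinearMap.comp_apply, LinearMap.comp_apply, leftTranslate_leftMul,
            ← leftTranslate_mul, mul_inv_cancel, leftTranslate_one]
        refine DFunLike.coe_injective
          (hS.equalizer (ContinuousLinearMap.continuous _) (ContinuousLinearMap.continuous _)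
            (funext fun x => ?_))
        simp only [Function.comp_apply, mul_apply_eq_comp, hstar, hu, hφ]
        rw [← LinearMap.rTensor_comp_apply, ← LinearMap.rTensor_comp_apply]
        rw [hconj] }
  refine ⟨ρ, DFunLike.ext _ _ fun f => DFunLike.coe_injective
    (hS.equalizer (ContinuousLinearMap.continuous _) (ContinuousLinearMap.continuous _)
      (funext fun x => ?_))⟩
  simp only [Function.comp_apply]
  induction x with
  | zero => simp
  | add x y hx hy => rw [map_add, map_add, map_add, hx, hy]
  | tmul h ξ =>
    rw [evalTensor_tmul, (hint f h ξ).2]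
    rfl

end Disintegration

/-! ### Representations of the crossed product -/

section CrossedProduct

open StarSeminormFamily

theorem IsCStarSeminorm.sup {E : Type*} [NonUnitalRing E] [StarRing E] [Module ℂ E]
    {p q : Seminorm ℂ E} (hp : IsCStarSeminorm p) (hq : IsCStarSeminorm q) :
    IsCStarSeminorm (p ⊔ q) where
  mul_le a b := by
    simp only [Seminorm.sup_apply]
    refine max_le ((hp.mul_le a b).trans ?_) ((hq.mul_le a b).trans ?_)
    · gcongr <;> exact le_max_left _ _
    · gcongr <;> exact le_max_right _ _
  star_mul_self a := by
    simp only [Seminorm.sup_apply, hp.star_mul_self, hq.star_mul_self]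
    exact ((pow_left_monotoneOn (n := 2)).map_max (apply_nonneg p a) (apply_nonneg q a)).symm

theorem envelopingSeminorm_le {E : Type*} [NonUnitalRing E] [StarRing E] [Module ℂ E]
    (p : Seminorm ℂ E) (x : E) : envelopingSeminorm p x ≤ p x := by
  refine csSup_le (representationSeminorms_nonempty p) ?_ x
  rintro q ⟨H, _, _, _, φ, h1, h2⟩ x
  exact (h2 x).trans_le (h1 x)

variable (α μ) in
theorem continuous_of_enveloping : Continuous (HausdorffCompletion.of
    (HausdorffCompletion.family (familyL1 α μ)).enveloping : L1Algebra α μ → CrossedProduct α μ) := by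
  let Q := HausdorffCompletion.family (familyL1 α μ)
  let j : L1Algebra α μ →ₗ[ℂ] Q.enveloping.Carrier := LinearMap.id (M := L1Algebra α μ)
  refine (UniformSpace.Completion.continuous_coe Q.enveloping.Carrier).comp
    (show Continuous j from ?_)
  refine (Q.enveloping.withSeminorms.continuous_iff_continuous_comp j).2 ?_
  rintro ⟨_, _, ⟨N, rfl⟩, rfl⟩
  exact Seminorm.continuous_of_le (HausdorffCompletion.continuous_extend _ N)
    (envelopingSeminorm_le _)

variable (α μ) in
theorem denseRange_toCrossedProduct : DenseRange (toCrossedProduct α μ) :=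
  (HausdorffCompletion.denseRange_mk _).comp (HausdorffCompletion.denseRange_mk (familyL1 α μ))
    (continuous_of_enveloping α μ)

theorem NondegenerateRep.ext_of_toCrossedProduct {Ψ Θ : NondegenerateRep H (CrossedProduct α μ)}
    (h : ∀ f, Ψ.toHom (toCrossedProduct α μ f) = Θ.toHom (toCrossedProduct α μ f)) : Ψ = Θ := by
  have : Ψ.toHom = Θ.toHom := DFunLike.coe_injective
    ((denseRange_toCrossedProduct α μ).equalizer Ψ.continuous Θ.continuous (funext h))
  cases Ψ
  cases Θ
  congr

theorem ContinuousAction.IsInvariantCStarSeminorm.sup {p q : Seminorm ℂ A}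
    (hp : α.IsInvariantCStarSeminorm p) (hq : α.IsInvariantCStarSeminorm q) :
    α.IsInvariantCStarSeminorm (p ⊔ q) where
  isCStarSeminorm := hp.isCStarSeminorm.sup hq.isCStarSeminorm
  continuous := hp.continuous.sup hq.continuous
  invariant t a := by rw [Seminorm.sup_apply, Seminorm.sup_apply, hp.invariant, hq.invariant]

theorem seminormL1_mono {p q : Seminorm ℂ A} (hp : Continuous p) (hq : Continuous q) (h : p ≤ q)
    (f : ConvAlgebra α μ) : seminormL1 p hp f ≤ seminormL1 q hq f := by
  have hi {p : Seminorm ℂ A} (hp : Continuous p) : Integrable (fun s => p (f s)) μ :=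
    (hp.comp f.continuous).integrable_of_hasCompactSupport
      (f.hasCompactSupport.comp_left (map_zero p))
  exact integral_mono (hi hp) (hi hq) fun s => h (f s)

/-- On the image of `C_c(G, A)`, a continuous representation of the crossed product is bounded by a
multiple of a single seminorm `N_p`, because the invariant `C*`-seminorms are directed. -/
theorem NondegenerateRep.exists_norm_le (Ψ : NondegenerateRep H (CrossedProduct α μ)) :
    ∃ p : Seminorm ℂ A, Continuous p ∧ ∃ C : ℝ, ∀ f : ConvAlgebra α μ,
      ‖Ψ.toHom (toCrossedProduct α μ f)‖ ≤ C * ∫ s, p (f s) ∂μ := by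
  let P := familyL1 α μ
  let Q := HausdorffCompletion.family P
  let q : Seminorm ℂ Q.enveloping.Carrier := (normSeminorm ℂ (H →L[ℂ] H)).comp
    (Ψ.toHom.comp (HausdorffCompletion.of Q.enveloping) : L1Algebra α μ →ₗ[ℂ] (H →L[ℂ] H))
  have hq : Continuous q :=
    (Ψ.continuous.comp (UniformSpace.Completion.continuous_coe Q.enveloping.Carrier)).norm
  obtain ⟨S, C, -, hle⟩ := Seminorm.bound_of_continuous Q.enveloping.withSeminorms q hq
  have hS : ∃ (p : Seminorm ℂ A) (hp : α.IsInvariantCStarSeminorm p), ∀ f : ConvAlgebra α μ,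
      S.sup Q.enveloping.seminorm (HausdorffCompletion.mk P f) ≤
        seminormL1 p hp.continuous f := by
    clear hle
    classical
    induction S using Finset.induction_on with
    | empty =>
      refine ⟨0, ⟨⟨fun a b => by simp, fun a => by simp⟩, continuous_zero, fun t a => rfl⟩,
        fun f => ?_⟩
      rw [Finset.sup_empty]
      exact apply_nonneg _ _
    | insert i S _ ih =>
      obtain ⟨p, hp, h⟩ := ih
      obtain ⟨_, _, ⟨⟨_, p', hp', rfl⟩, rfl⟩, rfl⟩ := i
      refine ⟨p' ⊔ p, hp'.sup hp, fun f => ?_⟩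
      rw [Finset.sup_insert]
      refine max_le ?_ ((h f).trans (seminormL1_mono _ _ le_sup_right f))
      exact ((envelopingSeminorm_le (HausdorffCompletion.extend P _)
        (HausdorffCompletion.mk P f)).trans_eq (HausdorffCompletion.extend_mk P _ f)).trans
        (seminormL1_mono hp'.continuous _ le_sup_left f)
  obtain ⟨p, hp, h⟩ := hS
  refine ⟨p, hp.continuous, C, fun f => ?_⟩
  refine (hle (HausdorffCompletion.mk P f)).trans ?_
  exact mul_le_mul_of_nonneg_left (h f) C.2

variable (μ) in
/-- The integrated form of a covariant representation extends to the crossed product. -/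
theorem NondegenerateCovariantRep.exists_rep_crossedProduct (ρ : NondegenerateCovariantRep H α) :
    ∃ Ψ : NondegenerateRep H (CrossedProduct α μ),
      ∀ f, Ψ.toHom (toCrossedProduct α μ f) = ρ.integratedHom μ f := by
  let P := familyL1 α μ
  let Q := HausdorffCompletion.family P
  have hp := ρ.isInvariantCStarSeminorm
  let N : P.carrier := ⟨seminormL1 ρ.seminorm hp.continuous, ρ.seminorm, hp, rfl⟩
  obtain ⟨Φ, -, hΦ, hΦN⟩ := HausdorffCompletion.exists_starHom_extension P (ρ.integratedHom μ) N
    ρ.norm_integrated_le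
  obtain ⟨Ψ, hΨc, hΨ, -⟩ := HausdorffCompletion.exists_starHom_extension Q.enveloping Φ
    ⟨envelopingSeminorm (HausdorffCompletion.extend P N), _, ⟨N, rfl⟩, rfl⟩
    (norm_le_envelopingSeminorm Φ hΦN)
  have h (f : ConvAlgebra α μ) : Ψ (toCrossedProduct α μ f) = ρ.integratedHom μ f :=
    (hΨ _).trans (hΦ f)
  refine ⟨⟨Ψ, hΨc, (isNondegenerate_iff Ψ).2 fun η hη => ?_⟩, h⟩
  refine (isNondegenerate_iff ρ.rep.toHom).1 ρ.rep.nondegenerate η fun a => ?_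
  have h0 := eq_zero_of_integral_smul_eq_zero μ (ρ.continuous_integrand (continuous_const (y := a)) η)
    (fun g hg hc => by rw [← ρ.integratedHom_tensor g hg hc, ← h, hη]) 1
  simpa [NondegenerateCovariantRep.op] using h0

variable (μ) in
theorem NondegenerateCovariantRep.integratedHom_injective {ρ σ : NondegenerateCovariantRep H α}
    (h : ρ.integratedHom μ = σ.integratedHom μ) : ρ = σ := by
  have key (a : A) (ξ : H) (t : G) :
      ρ.rep.toHom a (ρ.op t ξ) = σ.rep.toHom a (σ.op t ξ) := by
    have hρ := ρ.continuous_integrand (continuous_const (y := a)) ξ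
    have hσ := σ.continuous_integrand (continuous_const (y := a)) ξ
    have hsub : Continuous fun t => ρ.rep.toHom a (ρ.op t ξ) - σ.rep.toHom a (σ.op t ξ) :=
      hρ.sub hσ
    refine sub_eq_zero.1 (eq_zero_of_integral_smul_eq_zero μ hsub (fun g hg hc => ?_) t)
    have hi {F : G → H} (hF : Continuous F) : Integrable (fun t => (g t : ℂ) • F t) μ :=
      ((Complex.continuous_ofReal.comp hg).smul hF).integrable_of_hasCompactSupport
        (HasCompactSupport.smul_right (f := fun t => (g t : ℂ)) (hc.comp_left Complex.ofReal_zero))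
    simp only [smul_sub]
    rw [integral_sub (hi hρ) (hi hσ), ← ρ.integratedHom_tensor g hg hc,
      ← σ.integratedHom_tensor g hg hc, h, sub_self]
  have hrep : ρ.rep.toHom = σ.rep.toHom := by
    refine DFunLike.ext _ _ fun a => ContinuousLinearMap.ext fun ξ => ?_
    simpa [op] using key a ξ 1
  have hu : ρ.u = σ.u := by
    refine MonoidHom.ext fun t => Subtype.ext (ContinuousLinearMap.ext fun ξ => ?_)
    refine sub_eq_zero.1 ((isNondegenerate_iff ρ.rep.toHom).1 ρ.rep.nondegenerate _ fun a => ?_)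
    rw [map_sub, sub_eq_zero]
    exact (key a ξ t).trans (by rw [hrep])
  obtain ⟨⟨φ, _, _⟩, u, _, _⟩ := ρ
  obtain ⟨⟨ψ, _, _⟩, v, _, _⟩ := σ
  simp only at hrep hu
  subst hrep hu
  rfl

theorem NondegenerateRep.exists_integratedHom_eq (Ψ : NondegenerateRep H (CrossedProduct α μ)) :
    ∃ ρ : NondegenerateCovariantRep H α,
      ∀ f, Ψ.toHom (toCrossedProduct α μ f) = ρ.integratedHom μ f := by
  obtain ⟨p, hp, C, hC⟩ := Ψ.exists_norm_le
  let T := Ψ.toHom.comp (toCrossedProduct α μ)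
  have hnd : IsNondegenerate T := by
    refine (isNondegenerate_iff T).2 fun η hη => ?_
    refine (isNondegenerate_iff Ψ.toHom).1 Ψ.nondegenerate η fun x => ?_
    have hc := Ψ.continuous
    exact congrFun ((denseRange_toCrossedProduct α μ).equalizer
      (g := fun x => Ψ.toHom x η) (h := fun _ => 0) (by fun_prop) continuous_const (funext hη)) x
  obtain ⟨ρ, hρ⟩ := LocCStar.exists_integratedHom_eq T hp hC hnd
  exact ⟨ρ, fun f => (DFunLike.congr_fun hρ f).symm⟩

end CrossedProduct

end LocCStar

theorem proposition3p16
    {G : Type*} [Group G] [TopologicalSpace G] [IsTopologicalGroup G] [LocallyCompactSpace G]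
    [T2Space G] [MeasurableSpace G] [BorelSpace G] (μ : Measure G) [μ.IsHaarMeasure]
    {A : Type*} [LocallyCStarAlgebra A]
    (α : ContinuousAction G A) (hα : α.IsInverseLimitAction)
    (H : Type*) [NormedAddCommGroup H] [InnerProductSpace ℂ H] [CompleteSpace H] :
    ∃ e : NondegenerateCovariantRep H α ≃ NondegenerateRep H (CrossedProduct α μ),
      ∀ (ρ : NondegenerateCovariantRep H α) (f : ConvAlgebra α μ) (ξ : H),
        (e ρ).toHom (toCrossedProduct α μ f) ξ =
          ∫ t, ρ.rep.toHom (f t) ((ρ.u t : H →L[ℂ] H) ξ) ∂μ := by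
  choose e he using fun ρ : NondegenerateCovariantRep H α => ρ.exists_rep_crossedProduct μ
  refine ⟨Equiv.ofBijective e ⟨fun ρ σ h => ?_, fun Ψ => ?_⟩, fun ρ f ξ => ?_⟩
  · refine NondegenerateCovariantRep.integratedHom_injective μ (DFunLike.ext _ _ fun f => ?_)
    rw [← he, ← he, h]
  · obtain ⟨ρ, hρ⟩ := Ψ.exists_integratedHom_eq
    exact ⟨ρ, NondegenerateRep.ext_of_toCrossedProduct fun f => (he ρ f).trans (hρ f).symm⟩
  · exact DFunLike.congr_fun (he ρ f) ξ
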